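/- **Theorem (time complexity, threshold 2).** Consider the Galton–Watson process in which every node independently has two children or no child, each with probability $\tfrac12$, and let `ParallelGaltonWatson` with threshold $t=2$ generate its tree as follows. A thread has two queues $lds_1,lds_2$, the second one initially empty. As long as $lds_1$ is non-empty, it repeats the following operation: remove a node from the front of $lds_1$ if $lds_2$ is empty, otherwise from the front of $lds_2$; draw the fair random bit of this node; if the bit is $1$, create the two children of the node and append both to $lds_1$ if now $|lds_1|<t$, and otherwise append both to $lds_2$, after which, if $|lds_2|\ge t$, a new thread whose $lds_1$ consists of the contents of $lds_2$ is started and $lds_2$ is emptied. At first there is one thread, whose $lds_1$ contains only the root. In the fully parallel model all threads perform one operation simultaneously in each round. The level of a node is its distance from the root, and the running time $T$ is the number of rounds until all threads have ended. 1. For every outcome of the random bits, every node at level $h$ of the tree is processed in exactly one round, and the number of rounds preceding that round is $2h-1$ or $2h$. 2. For $n\ge 0$ let $T_n$ and $H_n$ be the running time $T$ and the height of the tree (the largest level of a node), conditioned on the tree having exactly $n$ internal nodes (that is, $2n+1$ nodes in total). Let $X$ be a random variable with the Theta law, that is, $X>0$ and $$\mathbb P(X>x)=\sum_{j\ge1}(4j^2x^2-2)\,e^{-j^2x^2}\qquad(x>0).$$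 Then, as $n\to\infty$, $$\frac{T_n}{4\sqrt{\pi n}}\longrightarrow \frac{X}{\sqrt\pi}\ \text{ in distribution},\qquad \mathbb E(T_n)\sim 4\sqrt{\pi n}.$$ The normalization is twice that of the height: $\dfrac{H_n}{2\sqrt{\pi n}}\longrightarrow \dfrac{X}{\sqrt\pi}$ in distribution. -/

import Mathlib

namespace ParallelGW

/-- A node of a binary tree, given by the path from the root (`false` = first child,
`true` = second child). The root is `[]`, and the level of a node is the length of its path. -/
abbrev Node : Type := List Bool

/-- The level of a node; the root is at level `0`. -/
def Node.level (v : Node) : ℕ := List.length v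

/-- The two children `n₁`, `n₂` of a node. -/
def Node.children (v : Node) : List Node := [v ++ [false], v ++ [true]]

/-- The nodes of the Galton-Watson tree determined by the bits drawn at the nodes: a node
belongs to the tree when every proper ancestor of it drew the bit `1`. -/
def InTree (bit : Node → Bool) (v : Node) : Prop :=
  ∀ u : Node, u <+: v → u ≠ v → bit u = true

/-- The set of nodes of the tree. -/
def treeNodes (bit : Node → Bool) : Set Node := {v | InTree bit v}

/-- The height of the tree: the largest level of a node (meaningful for a finite tree). -/
noncomputable def height (bit : Node → Bool) : ℕ := sSup (Node.level '' treeNodes bit)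

/-- The state of a thread: its two linear data structures, used as queues. -/
structure Thread where
  lds₁ : List Node
  lds₂ : List Node

/-- The node that the thread takes next, with the thread after its removal. The while loop of the
thread has ended (`none`) when `lds₁` is empty; otherwise a node is popped from `lds₁` if `lds₂` is
empty, and from `lds₂` if not. -/
def Thread.pop : Thread → Option (Node × Thread)
  | ⟨[], _⟩ => none
  | ⟨n :: q, []⟩ => some (n, ⟨q, []⟩)
  | ⟨n :: q, m :: r⟩ => some (m, ⟨n :: q, r⟩)

/-- One iteration of the while loop of `ParallelGaltonWatson` with threshold `t`. The result lists
the thread itself and the thread it has started, if any; a thread whose loop has ended is dropped. -/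
def Thread.step (t : ℕ) (bit : Node → Bool) (th : Thread) : List Thread :=
  match th.pop with
  | none => []
  | some (n, ⟨q₁, q₂⟩) =>
    if bit n = true then
      if q₁.length < t then [⟨q₁ ++ n.children, q₂⟩]
      else if t ≤ (q₂ ++ n.children).length then [⟨q₁, []⟩, ⟨q₂ ++ n.children, []⟩]
      else [⟨q₁, q₂ ++ n.children⟩]
    else [⟨q₁, q₂⟩]

/-- The threads after `k` rounds in the fully parallel model: in each round all threads
simultaneously perform one iteration of their loops. At first there is a single thread, whose
`lds₁` holds the root. -/
def threads (t : ℕ) (bit : Node → Bool) : ℕ → List Thread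
  | 0 => [⟨[[]], []⟩]
  | k + 1 => (threads t bit k).flatMap (Thread.step t bit)

/-- The node `v` is processed after `k` operations, that is, some thread pops `v` in the round that
follows the first `k` rounds. -/
def ProcessedAfter (t : ℕ) (bit : Node → Bool) (k : ℕ) (v : Node) : Prop :=
  ∃ th ∈ threads t bit k, ∃ th', th.pop = some (v, th')

/-- The running time in the fully parallel model: the number of rounds until the loops of all
threads have ended (meaningful if the run ends, in particular for a finite tree). -/
noncomputable def runningTime (t : ℕ) (bit : Node → Bool) : ℕ :=
  sInf {k | ∀ th ∈ threads t bit k, th.pop = none}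

/-- The distribution function of the Theta law, the law of a positive random variable `X` with
`ℙ(X > x) = ∑_{j ≥ 1} (4 j² x² - 2) exp(- j² x²)` for `x > 0`. -/
noncomputable def thetaCDF (x : ℝ) : ℝ :=
  if x ≤ 0 then 0
  else 1 - ∑' j : ℕ, (4 * ((j : ℝ) + 1) ^ 2 * x ^ 2 - 2) * Real.exp (-(((j : ℝ) + 1) ^ 2 * x ^ 2))

end ParallelGW

/-! Scheduling. At threshold 2 the threads stay in lockstep with the levels of the tree: after `2 *
m + 1` rounds every live thread holds exactly the two children of one internal node of level `m`
(`mem_threads_odd`), so level `m + 1` is consumed by the next two rounds. Hence the running time is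
between `2 * H` and `2 * H + 1` for a tree of height `H` (`runningTime_bounds`), and it depends on
the tree alone. A given tree with `n` internal nodes has probability `(1/2) ^ (2 * n + 1)`, so the
conditioned tree is uniform (`cond_real_eq_treeRatio`). What remains is the limit law of the height
of a uniform binary tree, with a tail bound for the expectation.

Height. The generating functions of trees of height at most `h` satisfy `y (h + 1) = 1 + z * y h ^
2`. With `4 * z = 1 - e ^ 2`, an affine substitution turns this into the logistic map `g ↦ (1 - e) *
g * (1 - g)`, whose reciprocal obeys an almost linear recursion. For `1 - e ^ 2 = exp (-s / h ^ 2)`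
it follows that `h` times the weighted sum over trees higher than `h` tends to `4 √s exp (-√s) / (1
- exp (-√s))` (`tendsto_mul_logisticIter`). This is `4 / √π` times the integral of the Theta tail
against `exp (-s / (4 x ^ 2))` (`integral_thetaTail_mul_exp`).

Inversion. At integers `s` these limits are moments in `u = exp (-n / h ^ 2)`. Karamata's polynomial
approximation turns them into limits of averages over windows of sizes `n`. To pass from averages to
a single `n` one needs a Tauberian condition, namely that the height is stochastically increasing in
`n` (`heightRatio_antitone`). This comes from a Markov chain that adds one node at a time and keeps
the tree uniform.

Expectation. The logistic bounds also give `P(H > h) ≤ C n / h ^ 2` (`exists_tail_bound`), hence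
domination by `C / (1 + x ^ 2)`. The limit mean is `√π / √π = 1`, by letting `s` tend to `0` in the
transform (`integral_thetaTail`). -/

namespace ParallelGW

/-! ### Binary trees of bounded height, and monotonicity of the height in the size -/

section Counting

open Finset BinaryTree

/-- The number of binary trees with `n` internal nodes and height at most `h`. -/
def heightCount : ℕ → ℕ → ℕ
  | 0, 0 => 1
  | 0, _ + 1 => 0
  | _ + 1, 0 => 1
  | h + 1, n + 1 => ∑ ij ∈ antidiagonal n, heightCount h ij.1 * heightCount h ij.2

theorem card_filter_height_le (h n : ℕ) :
    #{t ∈ treesOfNumNodesEq n | t.height ≤ h} = heightCount h n := by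
  induction h generalizing n with
  | zero =>
    cases n with
    | zero => simp [heightCount, filter_singleton, BinaryTree.height]
    | succ n =>
      rw [heightCount, card_eq_zero, filter_eq_empty_iff]
      intro t ht
      rw [mem_treesOfNumNodesEq] at ht
      cases t with
      | nil => simp [BinaryTree.numNodes] at ht
      | node => simp [BinaryTree.height]
  | succ h ih =>
    cases n with
    | zero => simp [heightCount, filter_singleton, BinaryTree.height]
    | succ n =>
      rw [treesOfNumNodesEq_succ, filter_biUnion, card_biUnion, heightCount]
      · refine sum_congr rfl fun ij _ => ?_
        rw [← ih, ← ih, ← card_product, filter_map, card_map]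
        congr 1
        ext ⟨a, b⟩
        have hab : (max a.height b.height + 1 ≤ h + 1) ↔ a.height ≤ h ∧ b.height ≤ h := by
          rw [Nat.succ_le_succ_iff, max_le_iff]
        rw [mem_filter, mem_product, mem_product, mem_filter, mem_filter]
        exact (and_congr_right fun _ => hab).trans and_and_and_comm
      · intro x _ y _ hxy
        rw [Function.onFun, disjoint_left]
        intro t h1 h2
        apply hxy
        simp only [mem_filter, mem_map, mem_product, mem_treesOfNumNodesEq] at h1 h2
        obtain ⟨⟨⟨a, b⟩, ⟨h3, h4⟩, rfl⟩, -⟩ := h1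
        obtain ⟨⟨⟨c, d⟩, ⟨h5, h6⟩, h7⟩, -⟩ := h2
        obtain ⟨-, rfl, rfl⟩ := BinaryTree.node.inj (h7 : node () c d = node () a b)
        ext
        · rw [← h3, ← h5]
        · rw [← h4, ← h6]

theorem heightCount_le_catalan (h n : ℕ) : heightCount h n ≤ catalan n := by
  rw [← card_filter_height_le, ← treesOfNumNodesEq_card_eq_catalan]
  exact card_filter_le _ _

theorem heightCount_eq_catalan {h n : ℕ} (hn : n ≤ h) : heightCount h n = catalan n := by
  rw [← card_filter_height_le, ← treesOfNumNodesEq_card_eq_catalan, filter_true_of_mem]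
  intro t ht
  rw [mem_treesOfNumNodesEq] at ht
  exact (t.height_le_numNodes.trans ht.le).trans hn

theorem catalan_pos (n : ℕ) : 0 < catalan n := by
  have h := succ_mul_catalan_eq_centralBinom n
  have := n.centralBinom_pos
  exact Nat.pos_of_ne_zero fun h0 => by simp [h0] at h; lia

theorem add_two_mul_catalan_succ (n : ℕ) :
    ((n : ℝ) + 2) * catalan (n + 1) = 2 * (2 * n + 1) * catalan n := by
  have h1 := succ_mul_catalan_eq_centralBinom n
  have h2 := succ_mul_catalan_eq_centralBinom (n + 1)
  have h3 := Nat.succ_mul_centralBinom_succ n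
  rw [← h1, ← h2] at h3
  have h4 : ((n : ℝ) + 1) * (((n : ℝ) + 1 + 1) * catalan (n + 1)) =
      2 * (2 * n + 1) * ((n + 1) * catalan n) := by exact_mod_cast h3
  have h5 : (n : ℝ) + 1 ≠ 0 := by positivity
  apply mul_left_cancel₀ h5
  linear_combination h4

theorem catalan_succ_eq (n : ℕ) :
    (catalan (n + 1) : ℝ) = 2 * (2 * n + 1) / (n + 2) * catalan n := by
  have h := add_two_mul_catalan_succ n
  field_simp
  linarith

/-- The probability that a uniform binary tree with `n + 1` internal nodes has `k` internal nodes
in its left subtree. -/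
noncomputable def splitProb (n k : ℕ) : ℝ := catalan k * catalan (n - k) / catalan (n + 1)

/-- The probability that, when a node is added to a uniform binary tree with `n + 1` internal nodes
of which `k` are in the left subtree, it is added to the left subtree. -/
noncomputable def growLeftProb (n k : ℕ) : ℝ :=
  (k + 1) * (2 * k + 1) * (3 * (n + 1) - 2 * k) / ((n + 1) * (n + 2) * (2 * n + 3))

theorem growLeftProb_nonneg {n k : ℕ} (hk : k ≤ n) : 0 ≤ growLeftProb n k := by
  have : (k : ℝ) ≤ n := by exact_mod_cast hk
  unfold growLeftProb
  apply div_nonneg _ (by positivity)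
  apply mul_nonneg (by positivity)
  linarith [(Nat.cast_nonneg k : (0 : ℝ) ≤ k)]

/-- Left-right symmetry of the growth: growing on the right is growing on the left in the mirror
image. -/
theorem one_sub_growLeftProb {n k : ℕ} (hk : k ≤ n) :
    1 - growLeftProb n k = growLeftProb n (n - k) := by
  unfold growLeftProb
  rw [Nat.cast_sub hk]
  field_simp
  ring

theorem splitProb_nonneg (n k : ℕ) : 0 ≤ splitProb n k := by
  unfold splitProb; positivity

/-- This identity and the next two say that one growth step carries the split law of a uniform tree
to that of a uniform tree with one more node. This one and `splitProb_succ_succ` force the formula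
for `growLeftProb`, by recursion on `k`; `splitProb_succ_self` is the consistency condition at the
other end. -/
theorem splitProb_succ_zero (n : ℕ) :
    splitProb (n + 1) 0 = (1 - growLeftProb n 0) * splitProb n 0 := by
  have := catalan_pos n
  rw [one_sub_growLeftProb (Nat.zero_le n)]
  simp only [splitProb, growLeftProb, catalan_succ_eq, Nat.sub_zero]
  push_cast
  field_simp
  ring

theorem splitProb_succ_self (n : ℕ) :
    splitProb (n + 1) (n + 1) = growLeftProb n n * splitProb n n := by
  have := catalan_pos n
  simp only [splitProb, growLeftProb, catalan_succ_eq, Nat.sub_self]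
  push_cast
  field_simp
  ring

theorem splitProb_succ_succ {n k : ℕ} (hk : k + 1 ≤ n) :
    splitProb (n + 1) (k + 1) =
      growLeftProb n k * splitProb n k + (1 - growLeftProb n (k + 1)) * splitProb n (k + 1) := by
  obtain ⟨m, rfl⟩ := Nat.exists_eq_add_of_le hk
  rw [one_sub_growLeftProb hk]
  have e1 : k + 1 + m - (k + 1) = m := by lia
  have e2 : k + 1 + m + 1 - (k + 1) = m + 1 := by lia
  have e3 : k + 1 + m - k = m + 1 := by lia
  simp only [splitProb, growLeftProb, e1, e2, e3]
  rw [catalan_succ_eq (k + 1 + m + 1), catalan_succ_eq m, catalan_succ_eq k]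
  have h1 := catalan_pos (k + 1 + m + 1)
  push_cast
  field_simp
  ring

/-- The probability that a uniform binary tree with `n` internal nodes has height at most `h`. -/
noncomputable def heightRatio (h n : ℕ) : ℝ := heightCount h n / catalan n

theorem heightRatio_nonneg (h n : ℕ) : 0 ≤ heightRatio h n := by
  unfold heightRatio; positivity

theorem heightRatio_le_one (h n : ℕ) : heightRatio h n ≤ 1 := by
  have := catalan_pos n
  unfold heightRatio
  rw [div_le_one (by positivity)]
  exact_mod_cast heightCount_le_catalan h n

theorem heightRatio_succ_zero (h : ℕ) : heightRatio (h + 1) 0 = 1 := by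
  simp [heightRatio, heightCount]

theorem heightRatio_zero_succ (n : ℕ) : heightRatio 0 (n + 1) = 0 := by
  simp [heightRatio, heightCount]

theorem heightRatio_succ_succ (h n : ℕ) : heightRatio (h + 1) (n + 1) =
    ∑ k ∈ range (n + 1), splitProb n k * (heightRatio h k * heightRatio h (n - k)) := by
  rw [heightRatio, heightCount, Finset.Nat.sum_antidiagonal_eq_sum_range_succ
    (fun i j => heightCount h i * heightCount h j), Nat.cast_sum, sum_div]
  refine sum_congr rfl fun k _ => ?_
  have h1 := catalan_pos k
  have h2 := catalan_pos (n - k)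
  have h3 := catalan_pos (n + 1)
  simp only [heightRatio, splitProb]
  push_cast
  field_simp

/-- Coupling: a growth step enlarges exactly one of the two subtrees, so it can only decrease the
product `b k * b (n - k)`. With `b` the height ratio this is the induction step of
`heightRatio_antitone`. -/
theorem sum_splitProb_succ_le {b : ℕ → ℝ} (hb : Antitone b) (hb0 : ∀ n, 0 ≤ b n) (n : ℕ) :
    ∑ k ∈ range (n + 2), splitProb (n + 1) k * (b k * b (n + 1 - k)) ≤
      ∑ k ∈ range (n + 1), splitProb n k * (b k * b (n - k)) := by
  -- Condition on the split before the growth step instead of after it.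
  have key : ∑ k ∈ range (n + 2), splitProb (n + 1) k * (b k * b (n + 1 - k)) =
      ∑ k ∈ range (n + 1), (growLeftProb n k * splitProb n k * (b (k + 1) * b (n - k)) +
        (1 - growLeftProb n k) * splitProb n k * (b k * b (n + 1 - k))) := by
    rw [sum_add_distrib, sum_range_succ, sum_range_succ', sum_range_succ (n := n), sum_range_succ'
      (fun k => (1 - growLeftProb n k) * splitProb n k * (b k * b (n + 1 - k))),
      splitProb_succ_zero, splitProb_succ_self]
    have : ∑ k ∈ range n, splitProb (n + 1) (k + 1) * (b (k + 1) * b (n + 1 - (k + 1))) =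
        ∑ k ∈ range n, growLeftProb n k * splitProb n k * (b (k + 1) * b (n - k)) +
        ∑ k ∈ range n, (1 - growLeftProb n (k + 1)) * splitProb n (k + 1) *
          (b (k + 1) * b (n + 1 - (k + 1))) := by
      rw [← sum_add_distrib]
      refine sum_congr rfl fun k hk => ?_
      rw [splitProb_succ_succ (by simpa using hk), Nat.add_sub_add_right]
      ring
    rw [this]
    simp only [Nat.sub_self, Nat.sub_zero]
    ring
  rw [key]
  refine sum_le_sum fun k hk => ?_
  have hk : k ≤ n := Nat.lt_succ_iff.1 (by simpa using hk)
  have h1 := growLeftProb_nonneg hk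
  have h2 : 0 ≤ 1 - growLeftProb n k := by
    rw [one_sub_growLeftProb hk]; exact growLeftProb_nonneg (Nat.sub_le _ _)
  have h3 := splitProb_nonneg n k
  have h4 : b (k + 1) * b (n - k) ≤ b k * b (n - k) :=
    mul_le_mul_of_nonneg_right (hb (Nat.le_succ k)) (hb0 _)
  have h5 : b k * b (n + 1 - k) ≤ b k * b (n - k) :=
    mul_le_mul_of_nonneg_left (hb (by lia)) (hb0 _)
  have h6 := mul_le_mul_of_nonneg_left h4 (mul_nonneg h1 h3)
  have h7 := mul_le_mul_of_nonneg_left h5 (mul_nonneg h2 h3)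
  linarith

/-- The height of a uniform binary tree with `n` internal nodes is stochastically increasing
in `n`. -/
theorem heightRatio_antitone (h : ℕ) : Antitone (heightRatio h) := by
  induction h with
  | zero =>
    refine antitone_nat_of_succ_le fun n => ?_
    rw [heightRatio_zero_succ]
    exact heightRatio_nonneg 0 n
  | succ h ih =>
    refine antitone_nat_of_succ_le fun n => ?_
    cases n with
    | zero => rw [heightRatio_succ_zero]; exact heightRatio_le_one _ _
    | succ n =>
      rw [heightRatio_succ_succ, heightRatio_succ_succ]
      exact sum_splitProb_succ_le ih (heightRatio_nonneg h) n

end Counting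

/-! ### Generating functions by height, and the logistic map -/

section GeneratingFunction

open Finset Filter Topology

/-- The iterates of the logistic map `g ↦ L g (1 - g)` started at `L / 4`. -/
noncomputable def logisticIter (L : ℝ) : ℕ → ℝ
  | 0 => L / 4
  | h + 1 => L * logisticIter L h * (1 - logisticIter L h)

theorem logisticIter_pos_and_le {L : ℝ} (hL0 : 0 < L) (hL1 : L < 1) (h : ℕ) :
    0 < logisticIter L h ∧ logisticIter L h ≤ 1 / 4 := by
  induction h with
  | zero => simp only [logisticIter]; constructor <;> linarith
  | succ h ih =>
    obtain ⟨h1, h2⟩ := ih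
    rw [logisticIter]
    have h3 : 0 < L * logisticIter L h := mul_pos hL0 h1
    have h4 : L * logisticIter L h ≤ 1 * logisticIter L h := by gcongr
    refine ⟨mul_pos h3 (by linarith), ?_⟩
    nlinarith

/-- Partial fractions: `1 / (g (1 - g)) = 1 / g + 1 + g / (1 - g)`. The last term is small, so the
reciprocals follow an affine recursion up to a controlled error. -/
theorem inv_logisticIter_succ {L : ℝ} (hL0 : 0 < L) (hL1 : L < 1) (h : ℕ) :
    L * (logisticIter L (h + 1))⁻¹ =
      (logisticIter L h)⁻¹ + 1 + logisticIter L h / (1 - logisticIter L h) := by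
  obtain ⟨h1, h2⟩ := logisticIter_pos_and_le hL0 hL1 h
  have h3 : 1 - logisticIter L h ≠ 0 := by linarith
  rw [logisticIter]
  field_simp
  ring

/-- The reciprocal `G` satisfies `L * G' ≥ G + 1`, so it grows by at least `1`. Feeding the linear
bound into `G' = L * G' + (1 - L) * G'` makes the increments linear in `h`, hence quadratic growth;
that second bound yields the tail estimate for the height. -/
theorem le_inv_logisticIter {L : ℝ} (hL0 : 0 < L) (hL1 : L < 1) (h : ℕ) :
    (h : ℝ) + 1 ≤ (logisticIter L h)⁻¹ ∧ (1 - L) * h ^ 2 / 2 ≤ (logisticIter L h)⁻¹ := by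
  induction h with
  | zero =>
    rw [logisticIter, inv_div]
    refine ⟨?_, by simp; positivity⟩
    rw [le_div_iff₀ hL0]
    push_cast
    linarith
  | succ h ih =>
    obtain ⟨h1, h2⟩ := logisticIter_pos_and_le hL0 hL1 h
    obtain ⟨h3, h4⟩ := logisticIter_pos_and_le hL0 hL1 (h + 1)
    have h5 := inv_logisticIter_succ hL0 hL1 h
    have h6 : 0 ≤ logisticIter L h / (1 - logisticIter L h) := div_nonneg h1.le (by linarith)
    have h7 : 0 < (logisticIter L (h + 1))⁻¹ := inv_pos.2 h3
    obtain ⟨i1, i2⟩ := ih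
    set G := (logisticIter L h)⁻¹
    set G' := (logisticIter L (h + 1))⁻¹
    have h8 : G + 1 ≤ L * G' := by linarith
    have h9 : G + 1 ≤ G' := by nlinarith
    have h10 : G + 1 + (1 - L) * (G + 1) ≤ G' := by
      nlinarith [mul_nonneg (sub_nonneg.2 hL1.le) (sub_nonneg.2 h9)]
    push_cast
    refine ⟨by linarith, ?_⟩
    nlinarith [mul_le_mul_of_nonneg_left i1 (sub_nonneg.2 hL1.le)]

theorem logisticIter_le_inv {L : ℝ} (hL0 : 0 < L) (hL1 : L < 1) (h : ℕ) :
    logisticIter L h ≤ 1 / ((h : ℝ) + 1) := by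
  have h1 := (le_inv_logisticIter hL0 hL1 h).1
  have h2 := (logisticIter_pos_and_le hL0 hL1 h).1
  rw [le_div_iff₀ (by positivity)]
  calc _ ≤ logisticIter L h * (logisticIter L h)⁻¹ := by gcongr
    _ = 1 := mul_inv_cancel₀ h2.ne'

theorem tendsto_logisticIter {L : ℝ} (hL0 : 0 < L) (hL1 : L < 1) :
    Tendsto (logisticIter L) atTop (𝓝 0) :=
  squeeze_zero (fun h => (logisticIter_pos_and_le hL0 hL1 h).1.le)
    (logisticIter_le_inv hL0 hL1) tendsto_one_div_add_atTop_nhds_zero_nat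

/-- Multiplying the recursion for the reciprocal by `L ^ h` makes it telescope. The main part is a
geometric sum, and the errors `g / (1 - g) ≤ 2 / (j + 1)` add up to a harmonic sum only. -/
theorem pow_mul_inv_logisticIter_bounds {L : ℝ} (hL0 : 0 < L) (hL1 : L < 1) (h : ℕ) :
    ∑ j ∈ range h, L ^ j ≤ L ^ h * (logisticIter L h)⁻¹ ∧
    L ^ h * (logisticIter L h)⁻¹ ≤
      4 / L + ∑ j ∈ range h, L ^ j + 2 * ∑ j ∈ range h, 1 / ((j : ℝ) + 1) := by
  induction h with
  | zero => simp [logisticIter]; positivity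
  | succ h ih =>
    obtain ⟨h1, h2⟩ := logisticIter_pos_and_le hL0 hL1 h
    have h3 := logisticIter_le_inv hL0 hL1 h
    have h4 : 0 ≤ logisticIter L h / (1 - logisticIter L h) := div_nonneg h1.le (by linarith)
    have h5 : logisticIter L h / (1 - logisticIter L h) ≤ 2 * (1 / ((h : ℝ) + 1)) := by
      rw [div_le_iff₀ (by linarith)]
      have : 0 < 1 / ((h : ℝ) + 1) := by positivity
      nlinarith
    have h6 : 0 < L ^ h := by positivity
    have h7 : L ^ h ≤ 1 := pow_le_one₀ hL0.le hL1.le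
    rw [pow_succ, mul_assoc, inv_logisticIter_succ hL0 hL1, sum_range_succ, sum_range_succ]
    obtain ⟨i1, i2⟩ := ih
    constructor
    · nlinarith [mul_nonneg h6.le h4]
    · have h8 := mul_le_mul h7 h5 h4 zero_le_one
      nlinarith

/-- The constant `2 / (1 + e)` is the fixed point of `y ↦ 1 + z * y ^ 2` for `z = (1 - e ^ 2) / 4`.
Measuring the distance to it in units of `4 / (1 + e)` gives exactly the logistic map with parameter
`1 - e`. -/
theorem hasSum_heightCount {e : ℝ} (he0 : 0 < e) (he1 : e < 1) (h : ℕ) :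
    HasSum (fun n => (heightCount h n : ℝ) * ((1 - e ^ 2) / 4) ^ n)
      (2 / (1 + e) - 4 / (1 + e) * logisticIter (1 - e) h) := by
  have hz : 0 ≤ (1 - e ^ 2) / 4 := by nlinarith
  induction h with
  | zero =>
    have : (2 / (1 + e) - 4 / (1 + e) * logisticIter (1 - e) 0) = 1 := by
      rw [logisticIter]; field_simp; ring
    rw [this]
    convert hasSum_single 0 (fun n hn => ?_) using 1
    · simp [heightCount]
    · obtain ⟨m, rfl⟩ := Nat.exists_eq_succ_of_ne_zero hn
      simp [heightCount]
  | succ h ih =>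
    set z := (1 - e ^ 2) / 4 with hzdef
    have hs : Summable fun n => ‖(heightCount h n : ℝ) * z ^ n‖ := by
      simpa only [Real.norm_of_nonneg (mul_nonneg (Nat.cast_nonneg _) (pow_nonneg hz _))]
        using ih.summable
    have hs2 := (summable_norm_sum_mul_antidiagonal_of_summable_norm hs hs).of_norm.hasSum
    rw [← tsum_mul_tsum_eq_tsum_sum_antidiagonal_of_summable_norm hs hs, ih.tsum_eq] at hs2
    -- Split off the empty tree; the other coefficients are those of `z` times the Cauchy square.
    rw [← hasSum_nat_add_iff' 1]
    convert hs2.mul_left z using 1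
    · rfl
    · ext n
      rw [heightCount, mul_sum, Nat.cast_sum, sum_mul]
      refine sum_congr rfl fun ij hij => ?_
      rw [HasAntidiagonal.mem_antidiagonal] at hij
      rw [← hij]
      push_cast
      ring
    · rw [sum_range_one, logisticIter, heightCount, hzdef]
      field_simp
      ring

/-- The probability `catalan n / 4 ^ n`, up to a factor `2`, that the Galton-Watson tree has `n`
internal nodes. -/
noncomputable def treeWeight (n : ℕ) : ℝ := catalan n / 4 ^ n

theorem treeWeight_pos (n : ℕ) : 0 < treeWeight n := by
  have := catalan_pos n
  unfold treeWeight; positivity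

/-- The Catalan generating function is the limit of the height-bounded ones. Its partial sums are
bounded because trees with fewer than `N` nodes have height at most `N`; conversely every
bounded-height series is termwise smaller, and the logistic iterates tend to `0`. -/
theorem hasSum_treeWeight {e : ℝ} (he0 : 0 < e) (he1 : e < 1) :
    HasSum (fun n => treeWeight n * (1 - e ^ 2) ^ n) (2 / (1 + e)) := by
  have hz : 0 ≤ (1 - e ^ 2) / 4 := by nlinarith
  have hterm : ∀ n, treeWeight n * (1 - e ^ 2) ^ n = catalan n * ((1 - e ^ 2) / 4) ^ n := by
    intro n; rw [treeWeight, div_pow]; ring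
  simp_rw [hterm]
  have hnn : ∀ n, 0 ≤ (catalan n : ℝ) * ((1 - e ^ 2) / 4) ^ n := fun n => by positivity
  have hpart : ∀ N, ∑ n ∈ range N, (catalan n : ℝ) * ((1 - e ^ 2) / 4) ^ n ≤ 2 / (1 + e) := by
    intro N
    have h1 := sum_le_hasSum (range N) (fun n _ => by positivity) (hasSum_heightCount he0 he1 N)
    have h2 := (logisticIter_pos_and_le (L := 1 - e) (by linarith) (by linarith) N).1
    have h3 : 0 < 4 / (1 + e) * logisticIter (1 - e) N := by positivity
    refine le_trans (le_of_eq ?_) (h1.trans (by linarith))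
    refine sum_congr rfl fun n hn => ?_
    rw [heightCount_eq_catalan (mem_range.1 hn).le]
  have hs := summable_of_sum_range_le hnn hpart
  have hle : ∑' n, (catalan n : ℝ) * ((1 - e ^ 2) / 4) ^ n ≤ 2 / (1 + e) :=
    Real.tsum_le_of_sum_range_le hnn hpart
  have hge : 2 / (1 + e) ≤ ∑' n, (catalan n : ℝ) * ((1 - e ^ 2) / 4) ^ n := by
    have hlim : Tendsto (fun h => 2 / (1 + e) - 4 / (1 + e) * logisticIter (1 - e) h) atTop
        (𝓝 (2 / (1 + e) - 4 / (1 + e) * 0)) :=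
      tendsto_const_nhds.sub ((tendsto_logisticIter (by linarith) (by linarith)).const_mul _)
    rw [mul_zero, sub_zero] at hlim
    refine le_of_tendsto' hlim fun h => ?_
    rw [← (hasSum_heightCount he0 he1 h).tsum_eq]
    refine (hasSum_heightCount he0 he1 h).summable.tsum_le_tsum (fun n => ?_) hs
    gcongr
    exact heightCount_le_catalan h n
  rw [← le_antisymm hle hge]
  exact hs.hasSum

theorem hasSum_treeWeight_mul_tail {e : ℝ} (he0 : 0 < e) (he1 : e < 1) (h : ℕ) :
    HasSum (fun n => treeWeight n * (1 - heightRatio h n) * (1 - e ^ 2) ^ n)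
      (4 / (1 + e) * logisticIter (1 - e) h) := by
  convert (hasSum_treeWeight he0 he1).sub (hasSum_heightCount he0 he1 h) using 1
  · rfl
  · ext n
    have := catalan_pos n
    rw [treeWeight, heightRatio, div_pow]
    field_simp
  · ring

end GeneratingFunction

/-! ### Scaling limits of the generating functions near the singularity -/

section Scaling

open Finset Filter Topology

theorem tendsto_mul_one_sub_exp (s : ℝ) :
    Tendsto (fun N : ℝ => N * (1 - Real.exp (-(s / N)))) atTop (𝓝 s) := by
  have h1 : HasDerivAt (fun t : ℝ => 1 - Real.exp (-(s * t))) s 0 := by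
    have h2 : HasDerivAt (fun t : ℝ => -(s * t)) (-(s * 1)) 0 :=
      ((hasDerivAt_id (0 : ℝ)).const_mul s).neg
    simpa using h2.exp.const_sub 1
  have h3 := h1.tendsto_slope_zero_right.comp tendsto_inv_atTop_nhdsGT_zero
  refine h3.congr fun N => ?_
  simp [div_eq_mul_inv]

/-- The quantity `√(1 - x)` for `x = exp (-s / N)`. -/
noncomputable def scaleEps (s N : ℝ) : ℝ := √(1 - Real.exp (-(s / N)))

theorem one_sub_scaleEps_sq {s N : ℝ} (hs : 0 ≤ s) (hN : 0 ≤ N) :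
    1 - scaleEps s N ^ 2 = Real.exp (-(s / N)) := by
  have : Real.exp (-(s / N)) ≤ 1 := Real.exp_le_one_iff.2 (neg_nonpos.2 (by positivity))
  rw [scaleEps, Real.sq_sqrt (by linarith)]
  ring

theorem scaleEps_pos {s N : ℝ} (hs : 0 < s) (hN : 0 < N) : 0 < scaleEps s N := by
  have : Real.exp (-(s / N)) < 1 := Real.exp_lt_one_iff.2 (neg_neg_of_pos (by positivity))
  exact Real.sqrt_pos.2 (by linarith)

theorem scaleEps_lt_one (s N : ℝ) : scaleEps s N < 1 := by
  rw [scaleEps, Real.sqrt_lt' one_pos]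
  linarith [Real.exp_pos (-(s / N))]

theorem tendsto_sqrt_mul_scaleEps (s : ℝ) :
    Tendsto (fun N : ℝ => √N * scaleEps s N) atTop (𝓝 √s) := by
  refine ((tendsto_mul_one_sub_exp s).sqrt).congr' ?_
  filter_upwards [eventually_ge_atTop 0] with N hN
  rw [scaleEps, Real.sqrt_mul hN]

theorem tendsto_scaleEps (s : ℝ) : Tendsto (scaleEps s) atTop (𝓝 0) := by
  have h1 : Tendsto (fun N : ℝ => √(1 - Real.exp (-(s / N)))) atTop
      (𝓝 √(1 - Real.exp (-0))) := by
    refine (Tendsto.sqrt ?_)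
    exact ((Real.continuous_exp.tendsto _).comp
      (tendsto_const_nhds.div_atTop tendsto_id).neg).const_sub 1
  rw [neg_zero, Real.exp_zero, sub_self, Real.sqrt_zero] at h1
  exact h1

/-- Each series tends to the constant `2`; only after cancelling it does the factor `√N` reveal the
square-root singularity. -/
theorem tendsto_sqrt_mul_weight_diff (s s' : ℝ) :
    Tendsto (fun N : ℝ => √N * (2 / (1 + scaleEps s N) - 2 / (1 + scaleEps s' N))) atTop
      (𝓝 (2 * (√s' - √s))) := by
  have h1 : Tendsto (fun N : ℝ => 2 * (√N * scaleEps s' N - √N * scaleEps s N) /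
      ((1 + scaleEps s N) * (1 + scaleEps s' N))) atTop
      (𝓝 (2 * (√s' - √s) / ((1 + 0) * (1 + 0)))) :=
    (((tendsto_sqrt_mul_scaleEps s').sub (tendsto_sqrt_mul_scaleEps s)).const_mul 2).div
      (((tendsto_scaleEps s).const_add 1).mul ((tendsto_scaleEps s').const_add 1)) (by norm_num)
  simp only [add_zero, mul_one, div_one] at h1
  refine h1.congr fun N => ?_
  have h2 : 0 ≤ scaleEps s N := Real.sqrt_nonneg _
  have h3 : 0 ≤ scaleEps s' N := Real.sqrt_nonneg _
  field_simp
  ring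

theorem tendsto_natCast_sq_atTop : Tendsto (fun h : ℕ => (h : ℝ) ^ 2) atTop atTop :=
  (tendsto_pow_atTop two_ne_zero).comp tendsto_natCast_atTop_atTop

/-- With `N = h ^ 2` one has `h * e → √s`, so `(1 - e) ^ h → exp (-√s)`. The geometric sum in
`pow_mul_inv_logisticIter_bounds`, divided by `h`, tends to `(1 - exp (-√s)) / √s`, and the
remaining terms vanish. -/
theorem tendsto_mul_logisticIter {s : ℝ} (hs : 0 < s) :
    Tendsto (fun h : ℕ => (h : ℝ) * (4 / (1 + scaleEps s ((h : ℝ) ^ 2)) *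
      logisticIter (1 - scaleEps s ((h : ℝ) ^ 2)) h)) atTop
      (𝓝 (4 * √s * (Real.exp (-√s) / (1 - Real.exp (-√s))))) := by
  have hsq := tendsto_natCast_sq_atTop
  set e : ℕ → ℝ := fun h => scaleEps s ((h : ℝ) ^ 2) with he
  have he0 : Tendsto e atTop (𝓝 0) := (tendsto_scaleEps s).comp hsq
  have hhe : Tendsto (fun h : ℕ => (h : ℝ) * e h) atTop (𝓝 √s) := by
    refine ((tendsto_sqrt_mul_scaleEps s).comp hsq).congr fun h => ?_
    simp [he]
  have hpow : Tendsto (fun h : ℕ => (1 - e h) ^ h) atTop (𝓝 (Real.exp (-√s))) := by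
    have := Real.tendsto_one_add_pow_exp_of_tendsto (g := fun h => -e h) (t := -√s)
      (by simpa using hhe.neg)
    simpa [sub_eq_add_neg] using this
  have hss : 0 < √s := Real.sqrt_pos.2 hs
  have hexp : Real.exp (-√s) < 1 := Real.exp_lt_one_iff.2 (by linarith)
  have hmain : Tendsto (fun h : ℕ => (1 - (1 - e h) ^ h) / ((h : ℝ) * e h)) atTop
      (𝓝 ((1 - Real.exp (-√s)) / √s)) := (hpow.const_sub 1).div hhe hss.ne'
  -- The harmonic error divided by `h` is a Cesàro mean of a null sequence.
  have hce : Tendsto (fun h : ℕ => (h : ℝ)⁻¹ * ∑ j ∈ range h, 1 / ((j : ℝ) + 1)) atTop (𝓝 0) :=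
    tendsto_one_div_add_atTop_nhds_zero_nat.cesaro
  have hinv : Tendsto (fun h : ℕ => (h : ℝ)⁻¹) atTop (𝓝 0) := tendsto_inv_atTop_nhds_zero_nat
  have hup : Tendsto (fun h : ℕ => (h : ℝ)⁻¹ * (4 / (1 - e h)) +
      (1 - (1 - e h) ^ h) / ((h : ℝ) * e h) +
      2 * ((h : ℝ)⁻¹ * ∑ j ∈ range h, 1 / ((j : ℝ) + 1))) atTop
      (𝓝 (0 * (4 / (1 - 0)) + (1 - Real.exp (-√s)) / √s + 2 * 0)) :=
    ((hinv.mul (tendsto_const_nhds.div (he0.const_sub 1) (by norm_num))).add hmain).add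
      (hce.const_mul 2)
  simp only [zero_mul, mul_zero, zero_add, add_zero] at hup
  have hu : Tendsto (fun h : ℕ => (h : ℝ)⁻¹ * ((1 - e h) ^ h * (logisticIter (1 - e h) h)⁻¹)) atTop
      (𝓝 ((1 - Real.exp (-√s)) / √s)) := by
    have hgeom : ∀ h : ℕ, 0 < h → (h : ℝ)⁻¹ * ∑ j ∈ range h, (1 - e h) ^ j =
        (1 - (1 - e h) ^ h) / ((h : ℝ) * e h) := by
      intro h hh
      have hp : 0 < e h := scaleEps_pos hs (by positivity)
      rw [geom_sum_eq (by linarith)]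
      have : (1 - e h - 1) = - e h := by ring
      rw [this]
      field_simp
      ring
    refine tendsto_of_tendsto_of_tendsto_of_le_of_le' hmain hup ?_ ?_
    · filter_upwards [eventually_gt_atTop 0] with h hh
      have hp : 0 < e h := scaleEps_pos hs (by positivity)
      have hb := (pow_mul_inv_logisticIter_bounds (L := 1 - e h)
        (by linarith [scaleEps_lt_one s ((h : ℝ) ^ 2)]) (by linarith) h).1
      rw [← hgeom h hh]
      gcongr
    · filter_upwards [eventually_gt_atTop 0] with h hh
      have hp : 0 < e h := scaleEps_pos hs (by positivity)
      have hb := (pow_mul_inv_logisticIter_bounds (L := 1 - e h)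
        (by linarith [scaleEps_lt_one s ((h : ℝ) ^ 2)]) (by linarith) h).2
      rw [← hgeom h hh]
      refine (mul_le_mul_of_nonneg_left hb (by positivity : (0 : ℝ) ≤ (h : ℝ)⁻¹)).trans
        (le_of_eq ?_)
      ring
  have hlim := (tendsto_const_nhds (x := (4 : ℝ))).div (he0.const_add 1) (by norm_num)|>.mul
    (hpow.div hu (by
      have : 0 < 1 - Real.exp (-√s) := by linarith
      positivity))
  have hval : 4 / (1 + 0) * (Real.exp (-√s) / ((1 - Real.exp (-√s)) / √s)) =
      4 * √s * (Real.exp (-√s) / (1 - Real.exp (-√s))) := by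
    have : 1 - Real.exp (-√s) ≠ 0 := by linarith
    field_simp
    ring
  rw [hval] at hlim
  refine hlim.congr' ?_
  filter_upwards [eventually_gt_atTop 0] with h hh
  have hp : 0 < e h := scaleEps_pos hs (by positivity)
  have hp1 : 0 < 1 - e h := by linarith [scaleEps_lt_one s ((h : ℝ) ^ 2)]
  have hg := (logisticIter_pos_and_le (L := 1 - e h) hp1 (by linarith) h).1
  simp only [Pi.div_apply]
  change _ = (h : ℝ) * (4 / (1 + e h) * logisticIter (1 - e h) h)
  field_simp

end Scaling

/-! ### Integrals of `exp (-a² x² - b² / x²)` -/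

section GaussianIntegrals

open Set Filter Topology MeasureTheory

/-- The primitives below contain `b / x`, whose default value at `0` is not the one-sided limit.
Redefining the primitive at the endpoint restores continuity. -/
theorem integral_Ioi_of_hasDerivAt_of_tendsto_nhdsGT {f f' : ℝ → ℝ} {a m n : ℝ}
    (hderiv : ∀ x ∈ Ioi a, HasDerivAt f (f' x) x) (hint : IntegrableOn f' (Ioi a))
    (hm : Tendsto f (𝓝[>] a) (𝓝 m)) (hn : Tendsto f atTop (𝓝 n)) :
    ∫ x in Ioi a, f' x = n - m := by
  have hc : ContinuousWithinAt (Function.update f a m) (Ici a) a := by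
    rw [continuousWithinAt_update_same, Ici_sdiff_left]
    exact hm
  have hev : ∀ x ∈ Ioi a, Function.update f a m =ᶠ[𝓝 x] f := fun x hx => by
    filter_upwards [Ioi_mem_nhds hx] with y hy
    exact Function.update_of_ne (ne_of_gt hy) _ _
  have := integral_Ioi_of_hasDerivAt_of_tendsto hc
    (fun x hx => (hderiv x hx).congr_of_eventuallyEq (hev x hx)) hint
    (hn.congr' ?_)
  · simpa using this
  · filter_upwards [eventually_gt_atTop a] with y hy
    exact (Function.update_of_ne (ne_of_gt hy) _ _).symm

theorem integrableOn_Ioi_deriv_of_nonneg_of_tendsto_nhdsGT {f f' : ℝ → ℝ} {a m n : ℝ}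
    (hderiv : ∀ x ∈ Ioi a, HasDerivAt f (f' x) x) (hpos : ∀ x ∈ Ioi a, 0 ≤ f' x)
    (hm : Tendsto f (𝓝[>] a) (𝓝 m)) (hn : Tendsto f atTop (𝓝 n)) :
    IntegrableOn f' (Ioi a) := by
  have hc : ContinuousWithinAt (Function.update f a m) (Ici a) a := by
    rw [continuousWithinAt_update_same, Ici_sdiff_left]
    exact hm
  have hev : ∀ x ∈ Ioi a, Function.update f a m =ᶠ[𝓝 x] f := fun x hx => by
    filter_upwards [Ioi_mem_nhds hx] with y hy
    exact Function.update_of_ne (ne_of_gt hy) _ _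
  refine integrableOn_Ioi_deriv_of_nonneg hc
    (fun x hx => (hderiv x hx).congr_of_eventuallyEq (hev x hx)) hpos (l := n) (hn.congr' ?_)
  filter_upwards [eventually_gt_atTop a] with y hy
  exact (Function.update_of_ne (ne_of_gt hy) _ _).symm

/-- The primitive of `t ↦ exp (-t ^ 2)` that vanishes at `0`. -/
noncomputable def gaussPrimitive (w : ℝ) : ℝ := ∫ t in (0 : ℝ)..w, Real.exp (-t ^ 2)

theorem hasDerivAt_gaussPrimitive (w : ℝ) :
    HasDerivAt gaussPrimitive (Real.exp (-w ^ 2)) w := by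
  have hc : Continuous fun t : ℝ => Real.exp (-t ^ 2) := by fun_prop
  exact intervalIntegral.integral_hasDerivAt_right (hc.intervalIntegrable _ _)
    (hc.stronglyMeasurableAtFilter _ _) hc.continuousAt

theorem tendsto_gaussPrimitive_atTop : Tendsto gaussPrimitive atTop (𝓝 (√Real.pi / 2)) := by
  have h1 := integral_gaussian_Ioi 1
  have h2 : Integrable fun t : ℝ => Real.exp (-t ^ 2) := by
    simpa using integrable_exp_neg_mul_sq one_pos
  simp only [neg_mul, one_mul, div_one] at h1
  rw [← h1]
  exact intervalIntegral_tendsto_integral_Ioi 0 h2.integrableOn tendsto_id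

theorem gaussPrimitive_neg (w : ℝ) : gaussPrimitive (-w) = -gaussPrimitive w := by
  have := intervalIntegral.integral_comp_neg (a := 0) (b := w) (fun t : ℝ => Real.exp (-t ^ 2))
  simp only [even_two.neg_pow, neg_zero] at this
  rw [gaussPrimitive, gaussPrimitive, this, intervalIntegral.integral_symm]

theorem tendsto_gaussPrimitive_atBot : Tendsto gaussPrimitive atBot (𝓝 (-(√Real.pi / 2))) := by
  refine (tendsto_gaussPrimitive_atTop.comp tendsto_neg_atBot_atTop).neg.congr fun w => ?_
  simp [gaussPrimitive_neg]

/-- The function `exp (- a ^ 2 x ^ 2 - b ^ 2 / x ^ 2)`. -/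
noncomputable def bridgeExp (a b x : ℝ) : ℝ := Real.exp (-(a ^ 2 * x ^ 2) - b ^ 2 / x ^ 2)

/-- Completing squares: `a² x² + b² / x²` equals `(a x - b / x)² + 2 a b` and also `(a x + b / x)² -
2 a b`. In the difference of the two substituted error functions the parts with factor `a` cancel,
leaving the part with `b / x ^ 2`. -/
theorem hasDerivAt_bridge_primitive (a : ℝ) {b x : ℝ} (hb : 0 < b) (hx : 0 < x) :
    HasDerivAt (fun x => (Real.exp (-(2 * a * b)) * gaussPrimitive (a * x - b / x) -
      Real.exp (2 * a * b) * gaussPrimitive (a * x + b / x)) / (2 * b))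
      (bridgeExp a b x / x ^ 2) x := by
  have h1 : HasDerivAt (fun x => b / x) (-b / x ^ 2) x := by
    simpa [div_eq_mul_inv] using (hasDerivAt_inv hx.ne').const_mul b
  have h2 : HasDerivAt (fun x => a * x) a x := by simpa using (hasDerivAt_id x).const_mul a
  have h3 := (hasDerivAt_gaussPrimitive (a * x - b / x)).comp x (h2.sub h1)
  have h4 := (hasDerivAt_gaussPrimitive (a * x + b / x)).comp x (h2.add h1)
  have h5 := ((h3.const_mul (Real.exp (-(2 * a * b)))).sub
    (h4.const_mul (Real.exp (2 * a * b)))).div_const (2 * b)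
  refine h5.congr_deriv ?_
  rw [← mul_assoc, ← mul_assoc, ← Real.exp_add, ← Real.exp_add]
  have e1 : -(2 * a * b) + -(a * x - b / x) ^ 2 = -(a ^ 2 * x ^ 2) - b ^ 2 / x ^ 2 := by
    field_simp; ring
  have e2 : 2 * a * b + -(a * x + b / x) ^ 2 = -(a ^ 2 * x ^ 2) - b ^ 2 / x ^ 2 := by
    field_simp; ring
  rw [e1, e2, bridgeExp]
  field_simp
  ring

theorem tendsto_bridge_primitive_zero {a b : ℝ} (hb : 0 < b) :
    Tendsto (fun x => (Real.exp (-(2 * a * b)) * gaussPrimitive (a * x - b / x) -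
      Real.exp (2 * a * b) * gaussPrimitive (a * x + b / x)) / (2 * b)) (𝓝[>] 0)
      (𝓝 ((Real.exp (-(2 * a * b)) * -(√Real.pi / 2) -
        Real.exp (2 * a * b) * (√Real.pi / 2)) / (2 * b))) := by
  have h1 : Tendsto (fun x : ℝ => b / x) (𝓝[>] 0) atTop :=
    (tendsto_inv_nhdsGT_zero.const_mul_atTop hb).congr fun x => by rw [div_eq_mul_inv]
  have h2 : Tendsto (fun x : ℝ => a * x) (𝓝[>] 0) (𝓝 (a * 0)) :=
    (tendsto_nhdsWithin_of_tendsto_nhds tendsto_id).const_mul a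
  have h3 : Tendsto (fun x : ℝ => a * x - b / x) (𝓝[>] 0) atBot := by
    simpa [sub_eq_add_neg] using h2.add_atBot (tendsto_neg_atTop_atBot.comp h1)
  exact (((tendsto_gaussPrimitive_atBot.comp h3).const_mul _).sub
    ((tendsto_gaussPrimitive_atTop.comp (h2.add_atTop h1)).const_mul _)).div_const _

theorem tendsto_bridge_primitive_atTop {a b : ℝ} (ha : 0 ≤ a) :
    Tendsto (fun x => (Real.exp (-(2 * a * b)) * gaussPrimitive (a * x - b / x) -
      Real.exp (2 * a * b) * gaussPrimitive (a * x + b / x)) / (2 * b)) atTop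
      (𝓝 ((Real.exp (-(2 * a * b)) * (√Real.pi / 2) -
        Real.exp (2 * a * b) * (√Real.pi / 2)) / (2 * b))) := by
  have h1 : Tendsto (fun x : ℝ => b / x) atTop (𝓝 0) := tendsto_const_nhds.div_atTop tendsto_id
  rcases ha.eq_or_lt with rfl | ha
  -- For `a = 0` both arguments tend to `0`, where the primitive vanishes; this case serves the
  -- weights without the height condition.
  · have hc : Tendsto gaussPrimitive (𝓝 0) (𝓝 (gaussPrimitive 0)) :=
      (hasDerivAt_gaussPrimitive 0).continuousAt.tendsto
    have h0 : gaussPrimitive 0 = 0 := by simp [gaussPrimitive]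
    rw [h0] at hc
    have h2 := ((hc.comp (by simpa using h1.neg)).sub (hc.comp h1)).div_const (2 * b)
    simpa using h2
  · have h2 : Tendsto (fun x : ℝ => a * x) atTop atTop := tendsto_id.const_mul_atTop ha
    have h3 : Tendsto (fun x : ℝ => a * x - b / x) atTop atTop := by
      simpa [sub_eq_add_neg] using h2.atTop_add h1.neg
    exact (((tendsto_gaussPrimitive_atTop.comp h3).const_mul _).sub
      ((tendsto_gaussPrimitive_atTop.comp (h2.atTop_add h1)).const_mul _)).div_const _

theorem integrableOn_bridgeExp_div_sq {a b : ℝ} (ha : 0 ≤ a) (hb : 0 < b) :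
    IntegrableOn (fun x => bridgeExp a b x / x ^ 2) (Ioi 0) :=
  integrableOn_Ioi_deriv_of_nonneg_of_tendsto_nhdsGT
    (fun _ hx => hasDerivAt_bridge_primitive a hb hx)
    (fun x _ => div_nonneg (Real.exp_pos _).le (sq_nonneg x))
    (tendsto_bridge_primitive_zero hb) (tendsto_bridge_primitive_atTop ha)

theorem integral_bridgeExp_div_sq {a b : ℝ} (ha : 0 ≤ a) (hb : 0 < b) :
    ∫ x in Ioi 0, bridgeExp a b x / x ^ 2 = √Real.pi * Real.exp (-(2 * a * b)) / (2 * b) := by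
  rw [integral_Ioi_of_hasDerivAt_of_tendsto_nhdsGT
    (fun _ hx => hasDerivAt_bridge_primitive a hb hx) (integrableOn_bridgeExp_div_sq ha hb)
    (tendsto_bridge_primitive_zero hb) (tendsto_bridge_primitive_atTop ha)]
  field_simp
  ring

theorem hasDerivAt_bridgeExp (a b : ℝ) {x : ℝ} (hx : 0 < x) :
    HasDerivAt (bridgeExp a b) (bridgeExp a b x * (-(2 * a ^ 2 * x) + 2 * b ^ 2 / x ^ 3)) x := by
  have h1 : HasDerivAt (fun x : ℝ => x ^ 2) (2 * x) x := by simpa using hasDerivAt_pow 2 x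
  have h2 : HasDerivAt (fun x : ℝ => -(a ^ 2 * x ^ 2) - b ^ 2 / x ^ 2)
      (-(2 * a ^ 2 * x) + 2 * b ^ 2 / x ^ 3) x := by
    have h3 := (h1.const_mul (a ^ 2)).neg.sub ((h1.inv (by positivity)).const_mul (b ^ 2))
    refine h3.congr_deriv ?_
    field_simp
    ring
  exact h2.exp

theorem bridgeExp_pos (a b x : ℝ) : 0 < bridgeExp a b x := Real.exp_pos _

theorem bridgeExp_le_one (a b x : ℝ) : bridgeExp a b x ≤ 1 := by
  have : 0 ≤ a ^ 2 * x ^ 2 + b ^ 2 / x ^ 2 := by positivity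
  exact Real.exp_le_one_iff.2 (by linarith)

theorem bridgeExp_le_left (a b x : ℝ) : bridgeExp a b x ≤ Real.exp (-(a ^ 2 * x ^ 2)) := by
  have : 0 ≤ b ^ 2 / x ^ 2 := by positivity
  exact Real.exp_le_exp.2 (by linarith)

theorem measurable_bridgeExp (a b : ℝ) : Measurable (bridgeExp a b) := by
  unfold bridgeExp; fun_prop

theorem abs_quadratic_mul_exp_le {y : ℝ} (hy : 0 ≤ y) :
    |4 * y - 2| * Real.exp (-y) ≤ 8 * Real.exp (-(y / 2)) := by
  have h1 : Real.exp (-y) = Real.exp (-(y / 2)) * Real.exp (-(y / 2)) := by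
    rw [← Real.exp_add]; ring_nf
  have h2 : |4 * y - 2| ≤ 4 * y + 2 := abs_le.2 ⟨by linarith, by linarith⟩
  have h3 : 1 + y / 2 ≤ Real.exp (y / 2) := by linarith [Real.add_one_le_exp (y / 2)]
  have h4 : Real.exp (y / 2) * Real.exp (-(y / 2)) = 1 := by rw [← Real.exp_add]; simp
  have h5 := Real.exp_pos (-(y / 2))
  have h6 : |4 * y - 2| * Real.exp (-(y / 2)) ≤ 8 :=
    calc |4 * y - 2| * Real.exp (-(y / 2)) ≤ (8 * Real.exp (y / 2)) * Real.exp (-(y / 2)) := by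
          gcongr; linarith
      _ = 8 := by rw [mul_assoc, h4, mul_one]
  rw [h1, ← mul_assoc]
  gcongr

theorem integrableOn_quadratic_mul_bridgeExp {a : ℝ} (ha : 0 < a) (b : ℝ) :
    IntegrableOn (fun x => (4 * a ^ 2 * x ^ 2 - 2) * bridgeExp a b x) (Ioi 0) := by
  have h1 : Integrable fun x : ℝ => 8 * Real.exp (-(a ^ 2 / 2) * x ^ 2) :=
    (integrable_exp_neg_mul_sq (by positivity)).const_mul 8
  refine h1.integrableOn.mono' ?_ (Eventually.of_forall fun x => ?_)
  · have := measurable_bridgeExp a b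
    exact Measurable.aestronglyMeasurable (by fun_prop)
  · rw [norm_mul, Real.norm_eq_abs, Real.norm_of_nonneg (bridgeExp_pos a b x).le]
    have h2 := abs_quadratic_mul_exp_le (y := a ^ 2 * x ^ 2) (by positivity)
    calc _ ≤ |4 * a ^ 2 * x ^ 2 - 2| * Real.exp (-(a ^ 2 * x ^ 2)) := by
          gcongr; exact bridgeExp_le_left a b x
      _ = |4 * (a ^ 2 * x ^ 2) - 2| * Real.exp (-(a ^ 2 * x ^ 2)) := by rw [mul_assoc 4]
      _ ≤ 8 * Real.exp (-(a ^ 2 * x ^ 2 / 2)) := h2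
      _ = 8 * Real.exp (-(a ^ 2 / 2) * x ^ 2) := by ring_nf

/-- The derivative of `-2 x * bridgeExp a b x` is this integrand minus `4 b²` times the one of
`integral_bridgeExp_div_sq`, and the boundary terms vanish. -/
theorem integral_quadratic_mul_bridgeExp {a b : ℝ} (ha : 0 < a) (hb : 0 < b) :
    ∫ x in Ioi 0, (4 * a ^ 2 * x ^ 2 - 2) * bridgeExp a b x =
      2 * b * √Real.pi * Real.exp (-(2 * a * b)) := by
  have hI1 := integrableOn_quadratic_mul_bridgeExp ha b
  have hI2 := integrableOn_bridgeExp_div_sq ha.le hb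
  have hd : ∀ x ∈ Ioi (0 : ℝ), HasDerivAt (fun x => -2 * (x * bridgeExp a b x))
      ((4 * a ^ 2 * x ^ 2 - 2) * bridgeExp a b x - 4 * b ^ 2 * (bridgeExp a b x / x ^ 2)) x := by
    intro x hx
    rw [mem_Ioi] at hx
    refine (((hasDerivAt_id x).mul (hasDerivAt_bridgeExp a b hx)).const_mul (-2)).congr_deriv ?_
    simp only [id]
    field_simp
    ring
  have h0 : Tendsto (fun x => -2 * (x * bridgeExp a b x)) (𝓝[>] 0) (𝓝 (-2 * 0)) := by
    refine Tendsto.const_mul _ ?_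
    refine tendsto_of_tendsto_of_tendsto_of_le_of_le' tendsto_const_nhds
      (tendsto_nhdsWithin_of_tendsto_nhds tendsto_id) ?_ ?_
    · filter_upwards [self_mem_nhdsWithin] with x hx
      exact mul_nonneg (le_of_lt hx) (bridgeExp_pos a b x).le
    · filter_upwards [self_mem_nhdsWithin] with x hx
      exact mul_le_of_le_one_right (le_of_lt hx) (bridgeExp_le_one a b x)
  have hinf : Tendsto (fun x => -2 * (x * bridgeExp a b x)) atTop (𝓝 (-2 * 0)) := by
    refine Tendsto.const_mul _ ?_
    have hz : Tendsto (fun x : ℝ => (1 / a ^ 2) * x⁻¹) atTop (𝓝 0) := by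
      have h := (tendsto_inv_atTop_zero (𝕜 := ℝ)).const_mul (1 / a ^ 2)
      rwa [mul_zero] at h
    refine tendsto_of_tendsto_of_tendsto_of_le_of_le' tendsto_const_nhds hz ?_ ?_
    · filter_upwards [eventually_gt_atTop 0] with x hx
      exact mul_nonneg (le_of_lt hx) (bridgeExp_pos a b x).le
    · filter_upwards [eventually_gt_atTop 0] with x hx
      have h1 : a ^ 2 * x ^ 2 ≤ Real.exp (a ^ 2 * x ^ 2) := by
        linarith [Real.add_one_le_exp (a ^ 2 * x ^ 2)]
      have h2 : 0 < a ^ 2 * x ^ 2 := by positivity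
      calc x * bridgeExp a b x ≤ x * Real.exp (-(a ^ 2 * x ^ 2)) := by
            gcongr; exact bridgeExp_le_left a b x
        _ ≤ x * (a ^ 2 * x ^ 2)⁻¹ := by rw [Real.exp_neg]; gcongr
        _ = (1 / a ^ 2) * x⁻¹ := by field_simp
  have hsum := integral_Ioi_of_hasDerivAt_of_tendsto_nhdsGT hd (hI1.sub (hI2.const_mul _)) h0 hinf
  rw [integral_sub hI1 (hI2.const_mul _), integral_const_mul,
    integral_bridgeExp_div_sq ha.le hb] at hsum
  rw [sub_eq_iff_eq_add.1 hsum]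
  field_simp
  ring

/-- For `a = 0` the function tends to `1` at infinity and is not integrable alone. The difference
is, by `1 - exp (-t) ≤ t`. -/
theorem integrableOn_bridgeExp_sub {b c : ℝ} (hb : 0 < b) (hbc : b < c) :
    IntegrableOn (fun x => bridgeExp 0 b x - bridgeExp 0 c x) (Ioi 0) ∧
    ∀ x : ℝ, 0 < x → 0 ≤ bridgeExp 0 b x - bridgeExp 0 c x ∧
      bridgeExp 0 b x - bridgeExp 0 c x ≤ (c ^ 2 - b ^ 2) * (bridgeExp 0 b x / x ^ 2) := by
  have hbd : ∀ x : ℝ, 0 < x → 0 ≤ bridgeExp 0 b x - bridgeExp 0 c x ∧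
      bridgeExp 0 b x - bridgeExp 0 c x ≤ (c ^ 2 - b ^ 2) * (bridgeExp 0 b x / x ^ 2) := by
    intro x hx
    have h1 : bridgeExp 0 c x = bridgeExp 0 b x * Real.exp (-((c ^ 2 - b ^ 2) / x ^ 2)) := by
      rw [bridgeExp, bridgeExp, ← Real.exp_add]
      ring_nf
    have h2 : 0 ≤ (c ^ 2 - b ^ 2) / x ^ 2 := by
      apply div_nonneg _ (sq_nonneg x); nlinarith
    have h3 := Real.one_sub_le_exp_neg ((c ^ 2 - b ^ 2) / x ^ 2)
    have h4 : Real.exp (-((c ^ 2 - b ^ 2) / x ^ 2)) ≤ 1 := Real.exp_le_one_iff.2 (by linarith)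
    have h5 := bridgeExp_pos 0 b x
    rw [h1]
    constructor
    · nlinarith
    · calc _ = bridgeExp 0 b x * (1 - Real.exp (-((c ^ 2 - b ^ 2) / x ^ 2))) := by ring
        _ ≤ bridgeExp 0 b x * ((c ^ 2 - b ^ 2) / x ^ 2) := by gcongr; linarith
        _ = _ := by ring
  refine ⟨?_, hbd⟩
  refine ((integrableOn_bridgeExp_div_sq le_rfl hb).const_mul (c ^ 2 - b ^ 2)).mono'
    ((measurable_bridgeExp 0 b).sub (measurable_bridgeExp 0 c)).aestronglyMeasurable ?_
  filter_upwards [ae_restrict_mem measurableSet_Ioi] with x hx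
  rw [Real.norm_of_nonneg (hbd x hx).1]
  exact (hbd x hx).2

/-- Integration by parts: `x` times the difference vanishes at both ends, which reduces the integral
to two cases of `integral_bridgeExp_div_sq` with `a = 0`. -/
theorem integral_bridgeExp_sub {b c : ℝ} (hb : 0 < b) (hbc : b < c) :
    ∫ x in Ioi 0, (bridgeExp 0 b x - bridgeExp 0 c x) = √Real.pi * (c - b) := by
  have hc := hb.trans hbc
  obtain ⟨hI, hbd⟩ := integrableOn_bridgeExp_sub hb hbc
  have hIb := (integrableOn_bridgeExp_div_sq le_rfl hb).const_mul (2 * b ^ 2)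
  have hIc := (integrableOn_bridgeExp_div_sq le_rfl hc).const_mul (2 * c ^ 2)
  have hd : ∀ x ∈ Ioi (0 : ℝ), HasDerivAt (fun x => x * (bridgeExp 0 b x - bridgeExp 0 c x))
      ((bridgeExp 0 b x - bridgeExp 0 c x) + (2 * b ^ 2 * (bridgeExp 0 b x / x ^ 2) -
        2 * c ^ 2 * (bridgeExp 0 c x / x ^ 2))) x := by
    intro x hx
    rw [mem_Ioi] at hx
    refine ((hasDerivAt_id x).mul ((hasDerivAt_bridgeExp 0 b hx).sub
      (hasDerivAt_bridgeExp 0 c hx))).congr_deriv ?_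
    simp only [id, Pi.sub_apply]
    field_simp
    ring
  have h0 : Tendsto (fun x => x * (bridgeExp 0 b x - bridgeExp 0 c x)) (𝓝[>] 0) (𝓝 0) := by
    refine tendsto_of_tendsto_of_tendsto_of_le_of_le' tendsto_const_nhds
      (tendsto_nhdsWithin_of_tendsto_nhds tendsto_id) ?_ ?_
    · filter_upwards [self_mem_nhdsWithin] with x hx
      exact mul_nonneg (le_of_lt hx) (hbd x hx).1
    · filter_upwards [self_mem_nhdsWithin] with x hx
      refine mul_le_of_le_one_right (le_of_lt hx) ?_
      linarith [bridgeExp_le_one 0 b x, bridgeExp_pos 0 c x]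
  have hinf : Tendsto (fun x => x * (bridgeExp 0 b x - bridgeExp 0 c x)) atTop (𝓝 0) := by
    have hz : Tendsto (fun x : ℝ => (c ^ 2 - b ^ 2) * x⁻¹) atTop (𝓝 0) := by
      simpa using tendsto_inv_atTop_zero.const_mul (c ^ 2 - b ^ 2)
    refine tendsto_of_tendsto_of_tendsto_of_le_of_le' tendsto_const_nhds hz ?_ ?_
    · filter_upwards [eventually_gt_atTop 0] with x hx
      exact mul_nonneg (le_of_lt hx) (hbd x hx).1
    · filter_upwards [eventually_gt_atTop 0] with x hx
      have h1 : 0 ≤ c ^ 2 - b ^ 2 := by nlinarith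
      calc x * (bridgeExp 0 b x - bridgeExp 0 c x)
          ≤ x * ((c ^ 2 - b ^ 2) * (1 / x ^ 2)) := by
            refine mul_le_mul_of_nonneg_left ((hbd x hx).2.trans ?_) hx.le
            gcongr
            exact bridgeExp_le_one 0 b x
        _ = _ := by field_simp
  have hI3 : IntegrableOn (fun x => 2 * b ^ 2 * (bridgeExp 0 b x / x ^ 2) -
      2 * c ^ 2 * (bridgeExp 0 c x / x ^ 2)) (Ioi 0) := hIb.sub hIc
  have hsum := integral_Ioi_of_hasDerivAt_of_tendsto_nhdsGT hd (hI.add hI3) h0 hinf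
  rw [integral_add hI hI3, integral_sub hIb hIc, integral_const_mul, integral_const_mul,
    integral_bridgeExp_div_sq le_rfl hb, integral_bridgeExp_div_sq le_rfl hc] at hsum
  rw [eq_sub_of_add_eq hsum]
  simp only [mul_zero, zero_mul, neg_zero, Real.exp_zero]
  field_simp
  ring

end GaussianIntegrals

/-! ### The Theta tail and its transform -/

section Theta

open Set Filter Topology MeasureTheory

/-- The terms of the series for the tail of the Theta law. -/
noncomputable def thetaTerm (j : ℕ) (x : ℝ) : ℝ :=
  (4 * ((j : ℝ) + 1) ^ 2 * x ^ 2 - 2) * Real.exp (-(((j : ℝ) + 1) ^ 2 * x ^ 2))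

/-- The tail `ℙ(X > x)` of the Theta law, for `x > 0`. -/
noncomputable def thetaTail (x : ℝ) : ℝ := ∑' j, thetaTerm j x

theorem thetaCDF_of_pos {x : ℝ} (hx : 0 < x) : thetaCDF x = 1 - thetaTail x := by
  rw [thetaCDF, if_neg (not_le.2 hx)]; rfl

theorem continuous_thetaTerm (j : ℕ) : Continuous (thetaTerm j) := by
  unfold thetaTerm; fun_prop

theorem abs_thetaTerm_le (j : ℕ) (x : ℝ) :
    |thetaTerm j x| ≤ 8 * Real.exp (-(((j : ℝ) + 1) ^ 2 * x ^ 2 / 2)) := by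
  rw [thetaTerm, abs_mul, abs_of_pos (Real.exp_pos _), mul_assoc 4]
  exact abs_quadratic_mul_exp_le (by positivity)

theorem abs_thetaTerm_le_geometric {a x : ℝ} (ha : 0 ≤ a) (hx : a ≤ x) (j : ℕ) :
    |thetaTerm j x| ≤ 8 * Real.exp (-(a ^ 2 / 2)) ^ (j + 1) := by
  refine (abs_thetaTerm_le j x).trans ?_
  rw [← Real.exp_nat_mul]
  gcongr
  push_cast
  have h1 : a ^ 2 ≤ x ^ 2 := by gcongr
  have h2 : (j : ℝ) + 1 ≤ ((j : ℝ) + 1) ^ 2 := by nlinarith [(Nat.cast_nonneg j : (0 : ℝ) ≤ j)]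
  have h3 : ((j : ℝ) + 1) * a ^ 2 ≤ ((j : ℝ) + 1) ^ 2 * x ^ 2 := by gcongr
  linarith

theorem summable_pow_succ {q : ℝ} (hq0 : 0 ≤ q) (hq : q < 1) : Summable fun j : ℕ => q ^ (j + 1) :=
  (summable_nat_add_iff 1).2 (summable_geometric_of_lt_one hq0 hq)

theorem tsum_pow_succ {q : ℝ} (hq0 : 0 ≤ q) (hq : q < 1) : ∑' j : ℕ, q ^ (j + 1) = q / (1 - q) := by
  simp_rw [pow_succ]
  rw [tsum_mul_right, tsum_geometric_of_lt_one hq0 hq]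
  field_simp

theorem continuousOn_thetaTail : ContinuousOn thetaTail (Ioi 0) := by
  intro x hx
  rw [mem_Ioi] at hx
  have h1 : ContinuousOn thetaTail (Ici (x / 2)) := by
    refine continuousOn_tsum (u := fun j : ℕ => 8 * Real.exp (-((x / 2) ^ 2 / 2)) ^ (j + 1))
      (fun j => (continuous_thetaTerm j).continuousOn) ?_
      (fun j y hy => abs_thetaTerm_le_geometric (by positivity) hy j)
    exact (summable_pow_succ (Real.exp_pos _).le
      (Real.exp_lt_one_iff.2 (by have := pow_pos (half_pos hx) 2; linarith))).mul_left 8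
  exact (h1.continuousAt (Ici_mem_nhds (by linarith))).continuousWithinAt

theorem thetaTerm_mul_exp (j : ℕ) {s : ℝ} (hs : 0 ≤ s) (x : ℝ) :
    thetaTerm j x * Real.exp (-(s / (4 * x ^ 2))) =
      (4 * ((j : ℝ) + 1) ^ 2 * x ^ 2 - 2) * bridgeExp (j + 1) (√s / 2) x := by
  rw [thetaTerm, mul_assoc, ← Real.exp_add, bridgeExp, div_pow, Real.sq_sqrt hs]
  congr 2
  rcases eq_or_ne x 0 with rfl | hx
  · simp
  · field_simp
    ring

/-- The series gives no uniform decay as `x` tends to `0`; the factor `exp (-s / (4 x²))` supplies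
it. Half of the exponent `(j + 1)² x² / 2` is spent in the inequality of arithmetic and geometric
means against `s / (4 x²)`, giving a geometric factor in `j`; the other half keeps a Gaussian in
`x`. -/
theorem abs_thetaTerm_mul_exp_le (j : ℕ) {s x : ℝ} (hs : 0 ≤ s) (hx : 0 < x) :
    |thetaTerm j x * Real.exp (-(s / (4 * x ^ 2)))| ≤
      8 * Real.exp (-(1 / 4) * x ^ 2) * Real.exp (-(√s / 2)) ^ (j + 1) := by
  rw [abs_mul, abs_of_pos (Real.exp_pos _)]
  calc _ ≤ 8 * Real.exp (-(((j : ℝ) + 1) ^ 2 * x ^ 2 / 2)) * Real.exp (-(s / (4 * x ^ 2))) := by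
        gcongr; exact abs_thetaTerm_le j x
    _ ≤ _ := by
        rw [← Real.exp_nat_mul, mul_assoc, mul_assoc, ← Real.exp_add, ← Real.exp_add]
        refine mul_le_mul_of_nonneg_left (Real.exp_le_exp.2 ?_) (by norm_num)
        push_cast
        have h1 : s / (4 * x ^ 2) = (√s / (2 * x)) ^ 2 := by
          rw [div_pow, Real.sq_sqrt hs]; ring
        have h2 : ((j : ℝ) + 1) * √s / 2 = 2 * (((j : ℝ) + 1) * x / 2) * (√s / (2 * x)) := by
          field_simp
        have h3 := two_mul_le_add_sq (((j : ℝ) + 1) * x / 2) (√s / (2 * x))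
        have h4 : x ^ 2 ≤ ((j : ℝ) + 1) ^ 2 * x ^ 2 := by
          refine le_mul_of_one_le_left (sq_nonneg x) ?_
          nlinarith [(Nat.cast_nonneg j : (0 : ℝ) ≤ j)]
        rw [h1]
        nlinarith

theorem integrable_thetaTerm_mul_exp (j : ℕ) {s : ℝ} (hs : 0 ≤ s) :
    IntegrableOn (fun x => thetaTerm j x * Real.exp (-(s / (4 * x ^ 2)))) (Ioi 0) := by
  simp_rw [thetaTerm_mul_exp j hs]
  exact integrableOn_quadratic_mul_bridgeExp (by positivity) _

theorem integrableOn_thetaTail_mul_exp {s : ℝ} (hs : 0 < s) :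
    IntegrableOn (fun x => thetaTail x * Real.exp (-(s / (4 * x ^ 2)))) (Ioi 0) := by
  have hq : Real.exp (-(√s / 2)) < 1 :=
    Real.exp_lt_one_iff.2 (by have := Real.sqrt_pos.2 hs; linarith)
  set q := Real.exp (-(√s / 2))
  have hsum := summable_pow_succ (Real.exp_pos _).le hq
  have h1 : Integrable fun x : ℝ =>
      8 * Real.exp (-(1 / 4) * x ^ 2) * ∑' j : ℕ, q ^ (j + 1) :=
    ((integrable_exp_neg_mul_sq (by norm_num)).const_mul 8).mul_const _
  refine h1.integrableOn.mono' ?_ ?_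
  · exact (continuousOn_thetaTail.aestronglyMeasurable measurableSet_Ioi).mul
      (Measurable.aestronglyMeasurable (by fun_prop))
  · filter_upwards [ae_restrict_mem measurableSet_Ioi] with x hx
    rw [thetaTail, ← tsum_mul_right, ← tsum_mul_left]
    exact tsum_of_norm_bounded (hsum.mul_left _).hasSum
      (fun j => abs_thetaTerm_mul_exp_le j hs.le hx)

/-- Termwise integration: the term of index `j` contributes `√π √s exp (-√s) ^ (j + 1)`, and the
geometric series sums to the logistic limit up to the factor `4 / √π`. -/
theorem integral_thetaTail_mul_exp {s : ℝ} (hs : 0 < s) :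
    ∫ x in Ioi 0, thetaTail x * Real.exp (-(s / (4 * x ^ 2))) =
      √Real.pi * √s * (Real.exp (-√s) / (1 - Real.exp (-√s))) := by
  have hss := Real.sqrt_pos.2 hs
  have hq : Real.exp (-(√s / 2)) < 1 := Real.exp_lt_one_iff.2 (by linarith)
  have hq' : Real.exp (-√s) < 1 := Real.exp_lt_one_iff.2 (by linarith)
  have hI : Integrable fun x : ℝ => 8 * Real.exp (-(1 / 4) * x ^ 2) :=
    (integrable_exp_neg_mul_sq (by norm_num)).const_mul 8
  have h1 := hasSum_integral_of_summable_integral_norm (μ := volume.restrict (Ioi 0))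
    (fun j => integrable_thetaTerm_mul_exp j hs.le) ?_
  · have h2 : ∀ j : ℕ, ∫ x in Ioi 0, thetaTerm j x * Real.exp (-(s / (4 * x ^ 2))) =
        √Real.pi * √s * Real.exp (-√s) ^ (j + 1) := by
      intro j
      simp_rw [thetaTerm_mul_exp j hs.le]
      rw [integral_quadratic_mul_bridgeExp (by positivity) (by positivity), ← Real.exp_nat_mul]
      push_cast
      ring_nf
    simp_rw [h2, tsum_mul_right] at h1
    rw [← tsum_pow_succ (Real.exp_pos _).le hq', ← tsum_mul_left]
    exact h1.tsum_eq.symm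
  · refine Summable.of_nonneg_of_le (fun j => by positivity) (fun j => ?_)
      ((summable_pow_succ (Real.exp_pos _).le hq).mul_left
        (∫ x in Ioi 0, 8 * Real.exp (-(1 / 4) * x ^ 2)))
    rw [← integral_mul_const]
    refine setIntegral_mono_on (integrable_thetaTerm_mul_exp j hs.le).norm
      (hI.mul_const _).integrableOn measurableSet_Ioi fun x hx => ?_
    exact abs_thetaTerm_mul_exp_le j hs.le hx

end Theta

/-! ### Convergence of moments implies convergence of functionals -/

section Moments

open Set Filter Topology MeasureTheory Polynomial

/-- Convergence of all moments of nonnegative weights on `[0, 1]` implies convergence of the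
integrals of all continuous functions. -/
theorem tendsto_tsum_mul_of_tendsto_moments {ι α : Type*} [MeasurableSpace α] {l : Filter ι}
    {μ : Measure α} {w u : ι → ℕ → ℝ} {ρ U : α → ℝ}
    (hsum : ∀ᶠ i in l, Summable (w i) ∧ ∀ n, 0 ≤ w i n ∧ u i n ∈ Icc (0 : ℝ) 1)
    (hρ : Integrable ρ μ) (hU : Measurable U) (hU01 : ∀ x, U x ∈ Icc (0 : ℝ) 1)
    (hmom : ∀ k : ℕ, Tendsto (fun i => ∑' n, w i n * u i n ^ k) l (𝓝 (∫ x, ρ x * U x ^ k ∂μ)))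
    {f : ℝ → ℝ} (hf : Continuous f) :
    Tendsto (fun i => ∑' n, w i n * f (u i n)) l (𝓝 (∫ x, ρ x * f (U x) ∂μ)) := by
  have hbdd : ∀ g : ℝ → ℝ, Continuous g → ∃ C : ℝ, 0 ≤ C ∧ ∀ x ∈ Icc (0 : ℝ) 1, |g x| ≤ C := by
    intro g hg
    obtain ⟨C, hC⟩ := isCompact_Icc.exists_bound_of_continuousOn (s := Icc (0 : ℝ) 1)
      hg.continuousOn
    exact ⟨C, (norm_nonneg _).trans (hC 0 (by simp)), hC⟩
  have hws : ∀ g : ℝ → ℝ, Continuous g → ∀ i,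
      (Summable (w i) ∧ ∀ n, 0 ≤ w i n ∧ u i n ∈ Icc (0 : ℝ) 1) →
      Summable fun n => w i n * g (u i n) := by
    rintro g hg i ⟨hi, hwu⟩
    obtain ⟨C, -, hC⟩ := hbdd g hg
    refine Summable.of_norm_bounded (hi.mul_right C) fun n => ?_
    rw [norm_mul, Real.norm_of_nonneg (hwu n).1]
    exact mul_le_mul_of_nonneg_left (hC _ (hwu n).2) (hwu n).1
  have hgi : ∀ g : ℝ → ℝ, Continuous g → Integrable (fun x => ρ x * g (U x)) μ := by
    intro g hg
    obtain ⟨C, -, hC⟩ := hbdd g hg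
    exact hρ.mul_bdd (c := C) (hg.measurable.comp hU).aestronglyMeasurable
      (Eventually.of_forall fun x => hC _ (hU01 x))
  have hpoly : ∀ p : ℝ[X], Tendsto (fun i => ∑' n, w i n * p.eval (u i n)) l
      (𝓝 (∫ x, ρ x * p.eval (U x) ∂μ)) := by
    intro p
    induction p using Polynomial.induction_on' with
    | add p q hp hq =>
      have h1 : ∫ x, ρ x * (p + q).eval (U x) ∂μ =
          ∫ x, ρ x * p.eval (U x) ∂μ + ∫ x, ρ x * q.eval (U x) ∂μ := by
        rw [← integral_add (hgi _ p.continuous) (hgi _ q.continuous)]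
        simp only [eval_add, mul_add]
      rw [h1]
      refine (hp.add hq).congr' ?_
      filter_upwards [hsum] with i hi
      rw [← (hws _ p.continuous i hi).tsum_add (hws _ q.continuous i hi)]
      simp only [eval_add, mul_add]
    | monomial k a =>
      simp only [eval_monomial]
      simp_rw [mul_left_comm _ a]
      rw [integral_const_mul]
      simp_rw [tsum_mul_left]
      exact (hmom k).const_mul a
  have htot : Tendsto (fun i => ∑' n, w i n) l (𝓝 (∫ x, ρ x ∂μ)) := by simpa using hmom 0
  rw [Metric.tendsto_nhds]
  intro ε hε
  set A := |∫ x, ρ x ∂μ| + 1 with hA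
  set B := ∫ x, |ρ x| ∂μ with hB
  have hB0 : 0 ≤ B := integral_nonneg fun x => abs_nonneg _
  have hA0 : 0 < A := by positivity
  -- `A` eventually bounds the total weight and `B` the mass of `|ρ|`, so the two approximation
  -- errors together cost `ε / 2`. The absolute value is needed since `ρ` is not assumed
  -- nonnegative.
  obtain ⟨p, hp⟩ := exists_polynomial_near_of_continuousOn 0 1 f hf.continuousOn
    (ε / (2 * (A + B))) (by positivity)
  have h3 : |∫ x, ρ x * p.eval (U x) ∂μ - ∫ x, ρ x * f (U x) ∂μ| ≤ ε / (2 * (A + B)) * B := by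
    rw [← integral_sub (hgi _ p.continuous) (hgi _ hf), hB, ← integral_const_mul,
      ← Real.norm_eq_abs]
    refine norm_integral_le_of_norm_le (hρ.abs.const_mul _) (Eventually.of_forall fun x => ?_)
    rw [← mul_sub, norm_mul, mul_comm]
    exact mul_le_mul_of_nonneg_right (hp _ (hU01 x)).le (norm_nonneg _)
  filter_upwards [hsum, htot.eventually (Iio_mem_nhds (show ∫ x, ρ x ∂μ < A by
      rw [hA]; linarith [le_abs_self (∫ x, ρ x ∂μ)])),
    Metric.tendsto_nhds.1 (hpoly p) (ε / 2) (by positivity)] with i hi hiA hip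
  have h4 : |∑' n, w i n * f (u i n) - ∑' n, w i n * p.eval (u i n)| ≤ ε / (2 * (A + B)) * A := by
    rw [← (hws _ hf i hi).tsum_sub (hws _ p.continuous i hi), ← Real.norm_eq_abs]
    refine (tsum_of_norm_bounded (hi.1.mul_left (ε / (2 * (A + B)))).hasSum fun n => ?_).trans ?_
    · rw [← mul_sub, norm_mul, Real.norm_of_nonneg (hi.2 n).1, mul_comm, norm_sub_rev]
      exact mul_le_mul_of_nonneg_right (hp _ (hi.2 n).2).le (hi.2 n).1
    · rw [tsum_mul_left]
      exact mul_le_mul_of_nonneg_left (le_of_lt hiA) (by positivity)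
  rw [Real.dist_eq] at hip ⊢
  have h5 : ε / (2 * (A + B)) * A + ε / (2 * (A + B)) * B = ε / 2 := by field_simp
  rw [abs_lt] at hip ⊢
  rw [abs_le] at h3 h4
  constructor <;> linarith [hip.1, hip.2, h3.1, h3.2, h4.1, h4.2]

end Moments

/-! ### From averages over sizes to a fixed size -/

section Tauberian

open Set Filter Topology MeasureTheory

/-- The reading on which the moment method rests: a `k`-th power of `u = exp (-n / N)` is an `n`-th
power, so moments in `u` are generating functions at `exp (-k / N)`. -/
theorem exp_neg_natCast_div_pow (N : ℝ) (n k : ℕ) :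
    Real.exp (-((n : ℝ) / N)) ^ k = Real.exp (-((k : ℝ) / N)) ^ n := by
  rw [← Real.exp_nat_mul, ← Real.exp_nat_mul]
  ring_nf

theorem exp_neg_natCast_div_mem {N : ℝ} (hN : 0 < N) (n : ℕ) :
    Real.exp (-((n : ℝ) / N)) ∈ Icc (0 : ℝ) 1 :=
  ⟨(Real.exp_pos _).le, Real.exp_le_one_iff.2 (neg_nonpos.2 (by positivity))⟩

theorem hasSum_treeWeight_mul_exp {N : ℝ} (hN : 0 < N) {k : ℕ} (hk : 0 < k) :
    HasSum (fun n : ℕ => treeWeight n * Real.exp (-((n : ℝ) / N)) ^ k)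
      (2 / (1 + scaleEps k N)) := by
  have := hasSum_treeWeight (scaleEps_pos (s := k) (by positivity) hN) (scaleEps_lt_one k N)
  rw [one_sub_scaleEps_sq (by positivity) hN.le] at this
  simpa only [exp_neg_natCast_div_pow] using this

theorem hasSum_treeWeight_mul_tail_mul_exp {N : ℝ} (hN : 0 < N) {k : ℕ} (hk : 0 < k) (h : ℕ) :
    HasSum (fun n : ℕ => treeWeight n * (1 - heightRatio h n) * Real.exp (-((n : ℝ) / N)) ^ k)
      (4 / (1 + scaleEps k N) * logisticIter (1 - scaleEps k N) h) := by
  have := hasSum_treeWeight_mul_tail (scaleEps_pos (s := k) (by positivity) hN)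
    (scaleEps_lt_one k N) h
  rw [one_sub_scaleEps_sq (by positivity) hN.le] at this
  simpa only [exp_neg_natCast_div_pow] using this

/-- The function `exp (-1 / (4 x ^ 2))`, which turns the scaled height `x` into the scaled size. -/
noncomputable def sizeMap (x : ℝ) : ℝ := Real.exp (-(1 / (4 * x ^ 2)))

theorem sizeMap_mem (x : ℝ) : sizeMap x ∈ Icc (0 : ℝ) 1 :=
  ⟨(Real.exp_pos _).le, Real.exp_le_one_iff.2 (neg_nonpos.2 (by positivity))⟩

theorem sizeMap_pow (x : ℝ) (k : ℕ) : sizeMap x ^ k = Real.exp (-((k : ℝ) / (4 * x ^ 2))) := by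
  rw [sizeMap, ← Real.exp_nat_mul]
  ring_nf

theorem sizeMap_pow_eq_bridgeExp (x : ℝ) (k : ℕ) : sizeMap x ^ k = bridgeExp 0 (√k / 2) x := by
  rw [sizeMap_pow, bridgeExp, div_pow, Real.sq_sqrt (Nat.cast_nonneg k)]
  congr 1
  rcases eq_or_ne x 0 with rfl | hx
  · simp
  · field_simp
    ring

theorem measurable_sizeMap : Measurable sizeMap := by unfold sizeMap; fun_prop

theorem sizeMap_lt {x y : ℝ} (hx : 0 < x) (hxy : x < y) : sizeMap x < sizeMap y := by
  refine Real.exp_lt_exp.2 (neg_lt_neg ?_)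
  gcongr

theorem sizeMap_lt_iff {x y : ℝ} (hx : 0 < x) (hy : 0 < y) : sizeMap x < sizeMap y ↔ x < y := by
  refine ⟨fun h => ?_, sizeMap_lt hx⟩
  by_contra! hle
  rcases hle.eq_or_lt with rfl | hlt
  · exact lt_irrefl _ h
  · exact lt_asymm h (sizeMap_lt hy hlt)

theorem sizeMap_pos (x : ℝ) : 0 < sizeMap x := Real.exp_pos _

theorem sizeMap_lt_one {x : ℝ} (hx : 0 < x) : sizeMap x < 1 :=
  Real.exp_lt_one_iff.2 (neg_neg_of_pos (by positivity))

/-- Here `N = h ^ 2`, so the normalization `√N` is `h`. The moments converge by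
`tendsto_mul_logisticIter` and are matched by `integral_thetaTail_mul_exp`. -/
theorem tendsto_tail_functional {f : ℝ → ℝ} (hf : Continuous f) :
    Tendsto (fun h : ℕ => ∑' n : ℕ, (h : ℝ) * (treeWeight n * (1 - heightRatio h n) *
        Real.exp (-((n : ℝ) / (h : ℝ) ^ 2))) * f (Real.exp (-((n : ℝ) / (h : ℝ) ^ 2)))) atTop
      (𝓝 (∫ x in Ioi 0, 4 / √Real.pi * (thetaTail x * sizeMap x) * f (sizeMap x))) := by
  refine tendsto_tsum_mul_of_tendsto_moments
    (w := fun (h n : ℕ) => (h : ℝ) * (treeWeight n * (1 - heightRatio h n) *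
      Real.exp (-((n : ℝ) / (h : ℝ) ^ 2))))
    (u := fun (h n : ℕ) => Real.exp (-((n : ℝ) / (h : ℝ) ^ 2)))
    (μ := volume.restrict (Ioi 0)) (ρ := fun x => 4 / √Real.pi * (thetaTail x * sizeMap x))
    (U := sizeMap) ?_ ?_ measurable_sizeMap sizeMap_mem ?_ hf
  · filter_upwards [eventually_gt_atTop 0] with h hh
    have hN : (0 : ℝ) < (h : ℝ) ^ 2 := by positivity
    refine ⟨?_, fun n => ⟨?_, exp_neg_natCast_div_mem hN n⟩⟩
    · simpa using (hasSum_treeWeight_mul_tail_mul_exp hN one_pos h).summable.mul_left (h : ℝ)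
    · have := heightRatio_le_one h n
      have := (treeWeight_pos n).le
      have : 0 ≤ 1 - heightRatio h n := by linarith
      positivity
  · exact (integrableOn_thetaTail_mul_exp one_pos).const_mul _
  -- The weight already carries one factor `u`, hence the parameter `k + 1`.
  · intro k
    have h1 := tendsto_mul_logisticIter (s := ((k + 1 : ℕ) : ℝ)) (by positivity)
    have h2 : ∫ x in Ioi 0, 4 / √Real.pi * (thetaTail x * sizeMap x) * sizeMap x ^ k =
        4 * √((k + 1 : ℕ) : ℝ) * (Real.exp (-√((k + 1 : ℕ) : ℝ)) /
          (1 - Real.exp (-√((k + 1 : ℕ) : ℝ)))) := by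
      have h3 : ∀ x, 4 / √Real.pi * (thetaTail x * sizeMap x) * sizeMap x ^ k =
          4 / √Real.pi * (thetaTail x * Real.exp (-(((k + 1 : ℕ) : ℝ) / (4 * x ^ 2)))) := by
        intro x
        rw [← sizeMap_pow]
        ring
      simp_rw [h3]
      rw [integral_const_mul, integral_thetaTail_mul_exp (by positivity)]
      have := Real.sqrt_pos.2 Real.pi_pos
      field_simp
    rw [h2]
    refine h1.congr' ?_
    filter_upwards [eventually_gt_atTop 0] with h hh
    rw [← (hasSum_treeWeight_mul_tail_mul_exp (N := (h : ℝ) ^ 2) (by positivity)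
      (by lia : 0 < k + 1) h).tsum_eq, ← tsum_mul_left]
    exact tsum_congr fun n => by ring

theorem summable_weight_functional {N : ℝ} (hN : 0 < N) :
    Summable fun n : ℕ => √N * (treeWeight n * (1 - Real.exp (-((n : ℝ) / N))) *
        Real.exp (-((n : ℝ) / N))) := by
  refine ((((hasSum_treeWeight_mul_exp hN one_pos).summable).sub
    ((hasSum_treeWeight_mul_exp hN two_pos).summable)).mul_left √N).congr fun n => ?_
  ring

/-- The factor `1 - u` suppresses the trees of bounded size, whose mass `√N` would blow up. In the
coordinate `n / N = 1 / (4 x ^ 2)` the limiting tree weights have constant density `4 / √π`. -/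
theorem tendsto_weight_functional {f : ℝ → ℝ} (hf : Continuous f) :
    Tendsto (fun N : ℝ => ∑' n : ℕ, √N * (treeWeight n * (1 - Real.exp (-((n : ℝ) / N))) *
        Real.exp (-((n : ℝ) / N))) * f (Real.exp (-((n : ℝ) / N)))) atTop
      (𝓝 (∫ x in Ioi 0, 4 / √Real.pi * ((1 - sizeMap x) * sizeMap x) * f (sizeMap x))) := by
  have hdiff : ∀ (k : ℕ) (x : ℝ), (1 - sizeMap x) * sizeMap x * sizeMap x ^ k =
      bridgeExp 0 (√((k + 1 : ℕ) : ℝ) / 2) x - bridgeExp 0 (√((k + 2 : ℕ) : ℝ) / 2) x := by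
    intro k x
    rw [← sizeMap_pow_eq_bridgeExp, ← sizeMap_pow_eq_bridgeExp]
    ring
  have hb : ∀ k : ℕ, 0 < √((k + 1 : ℕ) : ℝ) / 2 := fun k => by positivity
  have hbc : ∀ k : ℕ, √((k + 1 : ℕ) : ℝ) / 2 < √((k + 2 : ℕ) : ℝ) / 2 := fun k => by
    gcongr; norm_num
  refine tendsto_tsum_mul_of_tendsto_moments
    (w := fun (N : ℝ) (n : ℕ) => √N * (treeWeight n * (1 - Real.exp (-((n : ℝ) / N))) *
      Real.exp (-((n : ℝ) / N)))) (u := fun (N : ℝ) (n : ℕ) => Real.exp (-((n : ℝ) / N)))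
    (μ := volume.restrict (Ioi 0)) (ρ := fun x => 4 / √Real.pi * ((1 - sizeMap x) * sizeMap x))
    (U := sizeMap) ?_ ?_ measurable_sizeMap sizeMap_mem ?_ hf
  · filter_upwards [eventually_gt_atTop 0] with N hN
    refine ⟨summable_weight_functional hN, fun n => ⟨?_, exp_neg_natCast_div_mem hN n⟩⟩
    have h1 := (exp_neg_natCast_div_mem hN n)
    have := (treeWeight_pos n).le
    exact mul_nonneg (Real.sqrt_nonneg _) (mul_nonneg (mul_nonneg this (sub_nonneg.2 h1.2)) h1.1)
  · refine Integrable.const_mul ?_ _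
    refine (integrableOn_bridgeExp_sub (hb 0) (hbc 0)).1.congr (Eventually.of_forall fun x => ?_)
    simpa using (hdiff 0 x).symm
  · intro k
    have h1 := tendsto_sqrt_mul_weight_diff ((k + 1 : ℕ) : ℝ) ((k + 2 : ℕ) : ℝ)
    have h2 : ∫ x in Ioi 0, 4 / √Real.pi * ((1 - sizeMap x) * sizeMap x) * sizeMap x ^ k =
        2 * (√((k + 2 : ℕ) : ℝ) - √((k + 1 : ℕ) : ℝ)) := by
      simp_rw [mul_assoc (4 / √Real.pi), hdiff k]
      rw [integral_const_mul, integral_bridgeExp_sub (hb k) (hbc k)]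
      have := Real.sqrt_pos.2 Real.pi_pos
      field_simp
      ring
    rw [h2]
    refine h1.congr' ?_
    filter_upwards [eventually_gt_atTop 0] with N hN
    have e1 := hasSum_treeWeight_mul_exp hN (by lia : 0 < k + 1)
    have e2 := hasSum_treeWeight_mul_exp hN (by lia : 0 < k + 2)
    have e3 := ((e1.sub e2).mul_left √N).tsum_eq
    rw [← e3]
    exact tsum_congr fun n => by ring

/-- A continuous nonnegative function which is positive exactly on `(α, β)`. -/
noncomputable def bump (α β u : ℝ) : ℝ := max 0 ((u - α) * (β - u))

theorem continuous_bump (α β : ℝ) : Continuous (bump α β) := by unfold bump; fun_prop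

theorem bump_nonneg (α β u : ℝ) : 0 ≤ bump α β u := le_max_left _ _

theorem bump_pos_iff {α β u : ℝ} (h : α < β) : 0 < bump α β u ↔ α < u ∧ u < β := by
  rw [bump, lt_max_iff]
  constructor
  · rintro (h1 | h1)
    · exact absurd h1 (lt_irrefl _)
    · rcases pos_and_pos_or_neg_and_neg_of_mul_pos h1 with h2 | h2
      · exact ⟨by linarith [h2.1], by linarith [h2.2]⟩
      · linarith [h2.1, h2.2]
  · rintro ⟨h1, h2⟩
    exact Or.inr (mul_pos (by linarith) (by linarith))

theorem bump_le_one {α β u : ℝ} (hα : 0 ≤ α) (hαβ : α < β) (hβ : β ≤ 1)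
    (hu : u ∈ Icc (0 : ℝ) 1) : bump α β u ≤ 1 := by
  refine max_le zero_le_one ?_
  obtain ⟨hu0, hu1⟩ := hu
  rcases le_or_gt u α with h2 | h2
  · exact (mul_nonpos_of_nonpos_of_nonneg (by linarith) (by linarith)).trans zero_le_one
  rcases le_or_gt u β with h3 | h3
  · nlinarith
  · exact (mul_nonpos_of_nonneg_of_nonpos (by linarith) (by linarith)).trans zero_le_one

/-- The summands of the mass that the weights give to the bump between scaled heights `a` and
`b`. -/
noncomputable def windowTerm (a b N : ℝ) (n : ℕ) : ℝ :=
  √N * (treeWeight n * (1 - Real.exp (-((n : ℝ) / N))) * Real.exp (-((n : ℝ) / N))) *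
    bump (sizeMap a) (sizeMap b) (Real.exp (-((n : ℝ) / N)))

theorem windowTerm_nonneg (a b : ℝ) {N : ℝ} (hN : 0 < N) (n : ℕ) : 0 ≤ windowTerm a b N n := by
  obtain ⟨h1, h2⟩ := exp_neg_natCast_div_mem hN n
  have := (treeWeight_pos n).le
  exact mul_nonneg (mul_nonneg (Real.sqrt_nonneg _) (mul_nonneg (mul_nonneg this
    (sub_nonneg.2 h2)) h1)) (bump_nonneg _ _ _)

theorem summable_windowTerm {a b N : ℝ} (ha : 0 < a) (hab : a < b) (hN : 0 < N) :
    Summable (windowTerm a b N) := by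
  refine Summable.of_nonneg_of_le (windowTerm_nonneg a b hN) (fun n => ?_)
    (summable_weight_functional hN)
  obtain ⟨h1, h2⟩ := exp_neg_natCast_div_mem hN n
  have := (treeWeight_pos n).le
  exact mul_le_of_le_one_right (mul_nonneg (Real.sqrt_nonneg _) (mul_nonneg (mul_nonneg this
    (sub_nonneg.2 h2)) h1)) (bump_le_one (sizeMap_pos a).le (sizeMap_lt ha hab)
    (sizeMap_mem b).2 ⟨h1, h2⟩)

theorem windowTerm_pos_imp {a b N : ℝ} (ha : 0 < a) (hab : a < b) {n : ℕ}
    (h : windowTerm a b N n ≠ 0) : 1 / (4 * b ^ 2) < n / N ∧ n / N < 1 / (4 * a ^ 2) := by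
  have h1 : 0 < bump (sizeMap a) (sizeMap b) (Real.exp (-((n : ℝ) / N))) :=
    lt_of_le_of_ne (bump_nonneg _ _ _) fun h0 => h (by rw [windowTerm, ← h0, mul_zero])
  rw [bump_pos_iff (sizeMap_lt ha hab), sizeMap, sizeMap, Real.exp_lt_exp, Real.exp_lt_exp] at h1
  exact ⟨by linarith [h1.2], by linarith [h1.1]⟩

/-- The limit of the mass that the weights give to the bump between scaled heights `a` and `b`. -/
noncomputable def windowMass (a b : ℝ) : ℝ :=
  ∫ x in Ioi 0, 4 / √Real.pi * ((1 - sizeMap x) * sizeMap x) *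
    bump (sizeMap a) (sizeMap b) (sizeMap x)

theorem tendsto_tsum_windowTerm (a b : ℝ) :
    Tendsto (fun N => ∑' n, windowTerm a b N n) atTop (𝓝 (windowMass a b)) :=
  tendsto_weight_functional (continuous_bump _ _)

theorem integrableOn_mul_bump {a b : ℝ} (ha : 0 < a) (hab : a < b) {g : ℝ → ℝ}
    (hg : IntegrableOn g (Ioi 0)) :
    IntegrableOn (fun x => g x * bump (sizeMap a) (sizeMap b) (sizeMap x)) (Ioi 0) := by
  refine Integrable.mul_bdd (c := 1) hg ?_ (Eventually.of_forall fun x => ?_)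
  · exact ((continuous_bump _ _).measurable.comp measurable_sizeMap).aestronglyMeasurable
  · rw [Real.norm_of_nonneg (bump_nonneg _ _ _)]
    exact bump_le_one (sizeMap_pos a).le (sizeMap_lt ha hab) (sizeMap_mem b).2 (sizeMap_mem x)

theorem integrableOn_sizeMap_diff :
    IntegrableOn (fun x => 4 / √Real.pi * ((1 - sizeMap x) * sizeMap x)) (Ioi 0) := by
  refine Integrable.const_mul ?_ _
  refine (integrableOn_bridgeExp_sub (b := √((1 : ℕ) : ℝ) / 2) (c := √((2 : ℕ) : ℝ) / 2)
    (by positivity) (by gcongr; norm_num)).1.congr (Eventually.of_forall fun x => ?_)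
  simp only [← sizeMap_pow_eq_bridgeExp]
  ring

theorem windowMass_pos {a b : ℝ} (ha : 0 < a) (hab : a < b) : 0 < windowMass a b := by
  have hb := ha.trans hab
  have hp := Real.sqrt_pos.2 Real.pi_pos
  have hnn : ∀ x, 0 ≤ 4 / √Real.pi * ((1 - sizeMap x) * sizeMap x) *
      bump (sizeMap a) (sizeMap b) (sizeMap x) := fun x => by
    have := sub_nonneg.2 (sizeMap_mem x).2
    have := (sizeMap_pos x).le
    have := bump_nonneg (sizeMap a) (sizeMap b) (sizeMap x)
    positivity
  rw [windowMass, integral_pos_iff_support_of_nonneg hnn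
    (integrableOn_mul_bump ha hab integrableOn_sizeMap_diff)]
  refine lt_of_lt_of_le ?_ (measure_mono (s := Ioo a b) fun x hx => ?_)
  · rw [Measure.restrict_apply measurableSet_Ioo,
      inter_eq_left.2 (Ioo_subset_Ioi_self.trans (Ioi_subset_Ioi ha.le))]
    simpa using hab
  · have h1 : 0 < x := ha.trans hx.1
    have h2 := sub_pos.2 (sizeMap_lt_one h1)
    have h3 := sizeMap_pos x
    have h4 := (bump_pos_iff (sizeMap_lt ha hab)).2 ⟨sizeMap_lt ha hx.1, sizeMap_lt h1 hx.2⟩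
    exact (by positivity : (0 : ℝ) < _).ne'

/-- The limit of the part of the window mass that comes from trees of large height. -/
noncomputable def windowTailMass (a b : ℝ) : ℝ :=
  ∫ x in Ioi 0, thetaTail x * (4 / √Real.pi * ((1 - sizeMap x) * sizeMap x) *
    bump (sizeMap a) (sizeMap b) (sizeMap x))

theorem tendsto_tsum_windowTerm_mul_tail (a b : ℝ) :
    Tendsto (fun h : ℕ => ∑' n, windowTerm a b ((h : ℝ) ^ 2) n * (1 - heightRatio h n)) atTop
      (𝓝 (windowTailMass a b)) := by
  have h1 := tendsto_tail_functional (f := fun u => (1 - u) * bump (sizeMap a) (sizeMap b) u)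
    ((continuous_const.sub continuous_id).mul (continuous_bump _ _))
  have h2 : windowTailMass a b = ∫ x in Ioi 0, 4 / √Real.pi * (thetaTail x * sizeMap x) *
      ((1 - sizeMap x) * bump (sizeMap a) (sizeMap b) (sizeMap x)) :=
    integral_congr_ae (Eventually.of_forall fun x => by ring)
  rw [h2]
  refine h1.congr fun h => tsum_congr fun n => ?_
  rw [windowTerm, Real.sqrt_sq (Nat.cast_nonneg h)]
  ring

theorem integrableOn_windowTail {a b : ℝ} (ha : 0 < a) (hab : a < b) :
    IntegrableOn (fun x => thetaTail x * (4 / √Real.pi * ((1 - sizeMap x) * sizeMap x) *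
      bump (sizeMap a) (sizeMap b) (sizeMap x))) (Ioi 0) := by
  have h1 : IntegrableOn (fun x => thetaTail x * sizeMap x) (Ioi 0) :=
    integrableOn_thetaTail_mul_exp one_pos
  have h2 : IntegrableOn (fun x => 4 / √Real.pi * (thetaTail x * sizeMap x) * (1 - sizeMap x))
      (Ioi 0) := by
    refine Integrable.mul_bdd (c := 1) (h1.const_mul _)
      (measurable_const.sub measurable_sizeMap).aestronglyMeasurable
      (Eventually.of_forall fun x => ?_)
    rw [Real.norm_of_nonneg (sub_nonneg.2 (sizeMap_mem x).2)]
    linarith [(sizeMap_pos x)]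
  refine (integrableOn_mul_bump ha hab h2).congr (Eventually.of_forall fun x => ?_)
  ring

theorem windowWeight_nonneg (a b x : ℝ) : 0 ≤ 4 / √Real.pi * ((1 - sizeMap x) * sizeMap x) *
    bump (sizeMap a) (sizeMap b) (sizeMap x) := by
  have := sub_nonneg.2 (sizeMap_mem x).2
  have := (sizeMap_pos x).le
  have := bump_nonneg (sizeMap a) (sizeMap b) (sizeMap x)
  positivity

theorem mem_Ioo_of_bump_pos {a b x : ℝ} (ha : 0 < a) (hab : a < b) (hx : 0 < x)
    (h : 0 < bump (sizeMap a) (sizeMap b) (sizeMap x)) : x ∈ Ioo a b := by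
  rw [bump_pos_iff (sizeMap_lt ha hab), sizeMap_lt_iff ha hx, sizeMap_lt_iff hx (ha.trans hab)] at h
  exact h

theorem windowTailMass_le {a b A : ℝ} (ha : 0 < a) (hab : a < b)
    (hA : ∀ x ∈ Ioo a b, thetaTail x ≤ A) : windowTailMass a b ≤ A * windowMass a b := by
  rw [windowMass, ← integral_const_mul]
  refine setIntegral_mono_on (integrableOn_windowTail ha hab)
    ((integrableOn_mul_bump ha hab integrableOn_sizeMap_diff).const_mul A) measurableSet_Ioi
    fun x hx => ?_
  rcases (bump_nonneg (sizeMap a) (sizeMap b) (sizeMap x)).eq_or_lt with h0 | h0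
  · rw [← h0]; simp
  · exact mul_le_mul_of_nonneg_right (hA x (mem_Ioo_of_bump_pos ha hab hx h0))
      (windowWeight_nonneg a b x)

theorem le_windowTailMass {a b A : ℝ} (ha : 0 < a) (hab : a < b)
    (hA : ∀ x ∈ Ioo a b, A ≤ thetaTail x) : A * windowMass a b ≤ windowTailMass a b := by
  rw [windowMass, ← integral_const_mul]
  refine setIntegral_mono_on
    ((integrableOn_mul_bump ha hab integrableOn_sizeMap_diff).const_mul A)
    (integrableOn_windowTail ha hab) measurableSet_Ioi fun x hx => ?_
  rcases (bump_nonneg (sizeMap a) (sizeMap b) (sizeMap x)).eq_or_lt with h0 | h0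
  · rw [← h0]; simp
  · exact mul_le_mul_of_nonneg_right (hA x (mem_Ioo_of_bump_pos ha hab hx h0))
      (windowWeight_nonneg a b x)

theorem summable_windowTerm_mul_tail {a b N : ℝ} (ha : 0 < a) (hab : a < b) (hN : 0 < N) (h : ℕ) :
    Summable fun n => windowTerm a b N n * (1 - heightRatio h n) := by
  refine Summable.of_nonneg_of_le (fun n => mul_nonneg (windowTerm_nonneg a b hN n)
    (sub_nonneg.2 (heightRatio_le_one h n))) (fun n => ?_) (summable_windowTerm ha hab hN)
  exact mul_le_of_le_one_right (windowTerm_nonneg a b hN n)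
    (by linarith [heightRatio_nonneg h n])

/-- All sizes charged by the window exceed `m`, and larger trees are stochastically higher. The next
lemma is the opposite comparison, for `m` above the window. -/
theorem tail_mul_tsum_windowTerm_le {a b N : ℝ} (ha : 0 < a) (hab : a < b) (hN : 0 < N) {h m : ℕ}
    (hm : m / N ≤ 1 / (4 * b ^ 2)) :
    (1 - heightRatio h m) * ∑' n, windowTerm a b N n ≤
      ∑' n, windowTerm a b N n * (1 - heightRatio h n) := by
  rw [← tsum_mul_left]
  refine ((summable_windowTerm ha hab hN).mul_left _).tsum_le_tsum (fun n => ?_)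
    (summable_windowTerm_mul_tail ha hab hN h)
  rw [mul_comm]
  by_cases h0 : windowTerm a b N n = 0
  · rw [h0, zero_mul, zero_mul]
  · refine mul_le_mul_of_nonneg_left ?_ (windowTerm_nonneg a b hN n)
    have h1 := (windowTerm_pos_imp ha hab h0).1
    have h2 : (m : ℝ) < n := (div_lt_div_iff_of_pos_right hN).1 (hm.trans_lt h1)
    have h3 := heightRatio_antitone h (Nat.cast_lt.1 h2).le
    linarith

theorem tsum_windowTerm_le_tail_mul {a b N : ℝ} (ha : 0 < a) (hab : a < b) (hN : 0 < N) {h m : ℕ}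
    (hm : 1 / (4 * a ^ 2) ≤ m / N) :
    ∑' n, windowTerm a b N n * (1 - heightRatio h n) ≤
      (1 - heightRatio h m) * ∑' n, windowTerm a b N n := by
  rw [← tsum_mul_left]
  refine (summable_windowTerm_mul_tail ha hab hN h).tsum_le_tsum (fun n => ?_)
    ((summable_windowTerm ha hab hN).mul_left _)
  rw [mul_comm]
  by_cases h0 : windowTerm a b N n = 0
  · rw [h0, mul_zero, mul_zero]
  · refine mul_le_mul_of_nonneg_right ?_ (windowTerm_nonneg a b hN n)
    have h1 := (windowTerm_pos_imp ha hab h0).2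
    have h2 : (n : ℝ) < m := (div_lt_div_iff_of_pos_right hN).1 (h1.trans_le hm)
    have h3 := heightRatio_antitone h (Nat.cast_lt.1 h2).le
    linarith

/-- The height of a uniform binary tree, divided by `2 √n`, converges in distribution to the
Theta law. -/
theorem tendsto_one_sub_heightRatio {ι : Type*} {l : Filter ι} {h n : ι → ℕ} {y : ℝ} (hy : 0 < y)
    (hh : Tendsto h l atTop)
    (hn : Tendsto (fun i => (n i : ℝ) / (h i : ℝ) ^ 2) l (𝓝 (1 / (4 * y ^ 2)))) :
    Tendsto (fun i => 1 - heightRatio (h i) (n i)) l (𝓝 (thetaTail y)) := by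
  have hcont := continuousOn_thetaTail.continuousAt (Ioi_mem_nhds hy)
  rw [tendsto_order]
  constructor
  · intro A hA
    obtain ⟨A', hA1, hA2⟩ := exists_between hA
    -- A larger scaled height `x` means a smaller size. A window to the right of `y` therefore has
    -- sizes below `n i`, and its average tail bounds the tail at `n i` from below.
    obtain ⟨c, hc, hsub⟩ := exists_Ico_subset_of_mem_nhds
      (hcont.eventually (Ioi_mem_nhds hA2)) ⟨y + 1, by linarith⟩
    obtain ⟨a, ha1, ha2⟩ := exists_between hc
    have ha : 0 < a := hy.trans ha1
    have hmass := windowMass_pos ha ha2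
    have hle := le_windowTailMass (A := A') ha ha2 fun x hx =>
      le_of_lt (hsub ⟨(ha1.trans hx.1).le, hx.2⟩)
    have hK := (tendsto_tsum_windowTerm a c).comp (tendsto_natCast_sq_atTop.comp hh)
    have hM := (tendsto_tsum_windowTerm_mul_tail a c).comp hh
    have hlt : A * windowMass a c < windowTailMass a c := by nlinarith
    filter_upwards [hK.eventually (lt_mem_nhds hmass),
      (hK.const_mul A).eventually_lt hM hlt, hh.eventually_gt_atTop 0,
      hn.eventually (lt_mem_nhds (show 1 / (4 * a ^ 2) < 1 / (4 * y ^ 2) by gcongr))]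
      with i h1 h2 h3 h4
    have h5 := tsum_windowTerm_le_tail_mul ha ha2 (N := (h i : ℝ) ^ 2) (by positivity)
      (h := h i) h4.le
    simp only [Function.comp] at h1 h2
    exact lt_of_mul_lt_mul_right (h2.trans_le h5) h1.le
  · intro A hA
    obtain ⟨A', hA1, hA2⟩ := exists_between hA
    -- For the upper bound the window lies to the left of `y`, inside the positive axis, so its
    -- sizes exceed `n i`.
    obtain ⟨c, hc, hsub⟩ := exists_Ioc_subset_of_mem_nhds
      (hcont.eventually (Iio_mem_nhds hA1)) ⟨0, hy⟩
    obtain ⟨a, ha1, ha2⟩ := exists_between (max_lt hc hy)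
    obtain ⟨b, hb1, hb2⟩ := exists_between ha2
    have ha : 0 < a := (le_max_right _ _).trans_lt ha1
    have hca : c < a := (le_max_left _ _).trans_lt ha1
    have hb : 0 < b := ha.trans hb1
    have hmass := windowMass_pos ha hb1
    have hle := windowTailMass_le (A := A') ha hb1 fun x hx =>
      le_of_lt (hsub ⟨hca.trans hx.1, (hx.2.trans hb2).le⟩)
    have hK := (tendsto_tsum_windowTerm a b).comp (tendsto_natCast_sq_atTop.comp hh)
    have hM := (tendsto_tsum_windowTerm_mul_tail a b).comp hh
    have hlt : windowTailMass a b < A * windowMass a b := by nlinarith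
    filter_upwards [hK.eventually (lt_mem_nhds hmass),
      hM.eventually_lt (hK.const_mul A) hlt, hh.eventually_gt_atTop 0,
      hn.eventually (gt_mem_nhds (show 1 / (4 * y ^ 2) < 1 / (4 * b ^ 2) by gcongr))]
      with i h1 h2 h3 h4
    have h5 := tail_mul_tsum_windowTerm_le ha hb1 (N := (h i : ℝ) ^ 2) (by positivity)
      (h := h i) h4.le
    simp only [Function.comp] at h1 h2
    exact lt_of_mul_lt_mul_right (h5.trans_lt h2) h1.le

/-- A tail bound for the height of a uniform binary tree. -/
theorem exists_tail_bound : ∃ C : ℝ, 0 < C ∧ ∀ᶠ n : ℕ in atTop, ∀ h : ℕ, 0 < h →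
    1 - heightRatio h n ≤ C * n / h ^ 2 := by
  -- With `N = n` this window charges only sizes strictly between `n` and `4 n`.
  have hmass := windowMass_pos (a := 1 / 4) (b := 1 / 2) (by norm_num) (by norm_num)
  set κ := windowMass (1 / 4) (1 / 2)
  have hK : ∀ᶠ n : ℕ in atTop, κ / 2 < ∑' m, windowTerm (1 / 4) (1 / 2) n m :=
    ((tendsto_tsum_windowTerm _ _).comp tendsto_natCast_atTop_atTop).eventually
      (lt_mem_nhds (half_lt_self hmass))
  have hE : ∀ᶠ n : ℕ in atTop, (1 / 2 : ℝ) < √(n : ℝ) * scaleEps 1 n := by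
    refine ((tendsto_sqrt_mul_scaleEps 1).comp tendsto_natCast_atTop_atTop).eventually
      (lt_mem_nhds ?_)
    rw [Real.sqrt_one]; norm_num
  -- From `e > 1 / (2 √n)` and `g ≤ 2 / (e h²)` the window sum is at most `16 n / h²`; dividing by
  -- `κ / 2` gives the constant.
  refine ⟨32 / κ, by positivity, ?_⟩
  filter_upwards [hK, hE, eventually_gt_atTop 0] with n h1 h2 hn h hh
  have hN : (0 : ℝ) < n := by positivity
  have h3 := tail_mul_tsum_windowTerm_le (a := 1 / 4) (b := 1 / 2) (by norm_num) (by norm_num)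
    hN (h := h) (m := n) (by rw [div_self hN.ne']; norm_num)
  have hs := (hasSum_treeWeight_mul_tail_mul_exp hN one_pos h).mul_left √(n : ℝ)
  have h4 : ∑' m, windowTerm (1 / 4) (1 / 2) n m * (1 - heightRatio h m) ≤
      √(n : ℝ) * (4 / (1 + scaleEps (1 : ℕ) n) * logisticIter (1 - scaleEps (1 : ℕ) n) h) := by
    rw [← hs.tsum_eq]
    refine (summable_windowTerm_mul_tail (by norm_num) (by norm_num) hN h).tsum_le_tsum
      (fun m => ?_) hs.summable
    obtain ⟨hu0, hu1⟩ := exp_neg_natCast_div_mem hN m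
    have hb := bump_le_one (sizeMap_pos (1 / 4)).le
      (sizeMap_lt (x := 1 / 4) (y := 1 / 2) (by norm_num) (by norm_num))
      (sizeMap_mem (1 / 2)).2 ⟨hu0, hu1⟩
    have hb0 := bump_nonneg (sizeMap (1 / 4)) (sizeMap (1 / 2)) (Real.exp (-((m : ℝ) / n)))
    have hr := sub_nonneg.2 (heightRatio_le_one h m)
    have hw := (treeWeight_pos m).le
    rw [windowTerm, pow_one]
    set u := Real.exp (-((m : ℝ) / n))
    have hprod : (1 - u) * bump (sizeMap (1 / 4)) (sizeMap (1 / 2)) u ≤ 1 :=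
      mul_le_one₀ (by linarith) hb0 hb
    calc _ = √(n : ℝ) * (treeWeight m * (1 - heightRatio h m) * u) *
          ((1 - u) * bump (sizeMap (1 / 4)) (sizeMap (1 / 2)) u) := by ring
      _ ≤ _ := mul_le_of_le_one_right (by positivity) hprod
  rw [Nat.cast_one] at h4
  have he0 := scaleEps_pos one_pos hN
  have he1 := scaleEps_lt_one 1 n
  set e := scaleEps 1 n
  obtain ⟨hg0, -⟩ := logisticIter_pos_and_le (L := 1 - e) (by linarith) (by linarith) h
  have hg := (le_inv_logisticIter (L := 1 - e) (by linarith) (by linarith) h).2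
  rw [sub_sub_cancel] at hg
  set g := logisticIter (1 - e) h
  have hh' : (0 : ℝ) < (h : ℝ) ^ 2 := by positivity
  have hg2 : g * (e * h ^ 2) ≤ 2 := by
    have := mul_le_mul_of_nonneg_left hg hg0.le
    rw [mul_inv_cancel₀ hg0.ne'] at this
    linarith
  have hr := sub_nonneg.2 (heightRatio_le_one h n)
  set r := 1 - heightRatio h n
  have h5 : 4 / (1 + e) * g ≤ 4 * g := by
    gcongr
    rw [div_le_iff₀ (by linarith)]; linarith
  have hsq : √(n : ℝ) * √(n : ℝ) = n := Real.mul_self_sqrt hN.le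
  have hsn : 0 < √(n : ℝ) := Real.sqrt_pos.2 hN
  have h6 : r * (κ / 2) ≤ √(n : ℝ) * (4 * g) :=
    calc r * (κ / 2) ≤ r * ∑' m, windowTerm (1 / 4) (1 / 2) n m := by gcongr
      _ ≤ _ := h3.trans h4
      _ ≤ _ := by gcongr
  have h7 : g * h ^ 2 ≤ 4 * √(n : ℝ) := by
    have : g * h ^ 2 * (1 / 2) ≤ g * h ^ 2 * (√(n : ℝ) * e) := by gcongr
    nlinarith
  rw [le_div_iff₀ hh', div_mul_eq_mul_div, le_div_iff₀ hmass]
  have h8 : r * (κ / 2) * h ^ 2 ≤ √(n : ℝ) * (4 * g) * h ^ 2 := by gcongr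
  have h9 : √(n : ℝ) * (g * h ^ 2) ≤ √(n : ℝ) * (4 * √(n : ℝ)) := by gcongr
  nlinarith

end Tauberian

/-! ### Bounds for the Theta tail, and its mean -/

section ThetaIntegral

open Set Filter Topology MeasureTheory

theorem tendsto_natCast_div_sq {h : ℕ → ℕ} {y : ℝ} (hy : 0 < y)
    (hh : Tendsto (fun n : ℕ => (h n : ℝ) / √(n : ℝ)) atTop (𝓝 (2 * y))) :
    Tendsto h atTop atTop ∧
      Tendsto (fun n : ℕ => (n : ℝ) / (h n : ℝ) ^ 2) atTop (𝓝 (1 / (4 * y ^ 2))) := by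
  have hsq : Tendsto (fun n : ℕ => √(n : ℝ)) atTop atTop :=
    Real.tendsto_sqrt_atTop.comp tendsto_natCast_atTop_atTop
  constructor
  · rw [← tendsto_natCast_atTop_iff (R := ℝ)]
    refine (hsq.atTop_mul_pos (by positivity : 0 < 2 * y) hh).congr' ?_
    filter_upwards [eventually_gt_atTop 0] with n hn
    have : 0 < √(n : ℝ) := Real.sqrt_pos.2 (by positivity)
    field_simp
  · have h1 := (hh.pow 2).inv₀ (by positivity)
    have h2 : ((2 * y) ^ 2)⁻¹ = 1 / (4 * y ^ 2) := by field_simp; ring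
    rw [h2] at h1
    refine h1.congr fun n => ?_
    rw [div_pow, Real.sq_sqrt (Nat.cast_nonneg n), inv_div]

theorem tendsto_tail_of_div_sqrt {h : ℕ → ℕ} {y : ℝ} (hy : 0 < y)
    (hh : Tendsto (fun n : ℕ => (h n : ℝ) / √(n : ℝ)) atTop (𝓝 (2 * y))) :
    Tendsto (fun n : ℕ => 1 - heightRatio (h n) n) atTop (𝓝 (thetaTail y)) :=
  tendsto_one_sub_heightRatio hy (tendsto_natCast_div_sq hy hh).1 (tendsto_natCast_div_sq hy hh).2

theorem tendsto_floor_mul_sqrt_div {c : ℝ} (hc : 0 ≤ c) :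
    Tendsto (fun n : ℕ => (⌊c * √(n : ℝ)⌋₊ : ℝ) / √(n : ℝ)) atTop (𝓝 c) :=
  (tendsto_nat_floor_mul_div_atTop hc).comp
    (Real.tendsto_sqrt_atTop.comp tendsto_natCast_atTop_atTop)

/-- Near `0` the bounds are not visible from the series; they are inherited from the probabilities
whose limit the Theta tail is. -/
theorem thetaTail_bounds {C : ℝ} (hC : ∀ᶠ n : ℕ in atTop, ∀ h : ℕ, 0 < h →
    1 - heightRatio h n ≤ C * n / h ^ 2) {y : ℝ} (hy : 0 < y) :
    0 ≤ thetaTail y ∧ thetaTail y ≤ 1 ∧ thetaTail y * y ^ 2 ≤ C / 4 := by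
  have hfl := tendsto_floor_mul_sqrt_div (c := 2 * y) (by positivity)
  have hlim := tendsto_tail_of_div_sqrt hy hfl
  obtain ⟨h1, h2⟩ := tendsto_natCast_div_sq hy hfl
  refine ⟨ge_of_tendsto' hlim fun n => sub_nonneg.2 (heightRatio_le_one _ _),
    le_of_tendsto' hlim fun n => by linarith [heightRatio_nonneg ⌊2 * y * √(n : ℝ)⌋₊ n], ?_⟩
  have h3 : thetaTail y ≤ C * (1 / (4 * y ^ 2)) := by
    refine le_of_tendsto_of_tendsto hlim (h2.const_mul C) ?_
    filter_upwards [hC, h1.eventually_gt_atTop 0] with n hn hpos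
    rw [← mul_div_assoc]
    exact hn _ hpos
  calc thetaTail y * y ^ 2 ≤ C * (1 / (4 * y ^ 2)) * y ^ 2 := by gcongr
    _ = C / 4 := by field_simp

theorem exists_thetaTail_le : ∃ C : ℝ, ∀ y : ℝ, 0 < y →
    0 ≤ thetaTail y ∧ thetaTail y ≤ C * (1 + y ^ 2)⁻¹ := by
  obtain ⟨C, -, hC⟩ := exists_tail_bound
  refine ⟨1 + C / 4, fun y hy => ?_⟩
  obtain ⟨h1, h2, h3⟩ := thetaTail_bounds hC hy
  refine ⟨h1, ?_⟩
  rw [← div_eq_mul_inv, le_div_iff₀ (by positivity)]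
  linarith

/-- The Theta law has mean `√π`. -/
theorem integral_thetaTail : ∫ x in Ioi 0, thetaTail x = √Real.pi := by
  obtain ⟨C, hC⟩ := exists_thetaTail_le
  have hbound : IntegrableOn (fun y : ℝ => C * (1 + y ^ 2)⁻¹) (Ioi 0) :=
    (integrable_inv_one_add_sq.const_mul C).integrableOn
  -- The transform is evaluated along `s = (1 / (n + 1)) ^ 2`, which makes `√s` explicit.
  have hs0 : Tendsto (fun n : ℕ => (((n : ℝ) + 1)⁻¹) ^ 2) atTop (𝓝 0) := by
    simpa using (tendsto_one_div_add_atTop_nhds_zero_nat (𝕜 := ℝ)).pow 2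
  have h1 : Tendsto (fun n : ℕ => ∫ x in Ioi 0,
      thetaTail x * Real.exp (-((((n : ℝ) + 1)⁻¹) ^ 2 / (4 * x ^ 2)))) atTop
      (𝓝 (∫ x in Ioi 0, thetaTail x)) := by
    refine tendsto_integral_of_dominated_convergence (fun y : ℝ => C * (1 + y ^ 2)⁻¹)
      (fun n => ?_) hbound (fun n => ?_) ?_
    · exact (integrableOn_thetaTail_mul_exp (by positivity)).aestronglyMeasurable
    · filter_upwards [ae_restrict_mem measurableSet_Ioi] with x hx
      obtain ⟨h2, h3⟩ := hC x hx
      rw [norm_mul, Real.norm_of_nonneg h2, Real.norm_of_nonneg (Real.exp_pos _).le]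
      refine (mul_le_of_le_one_right h2 (Real.exp_le_one_iff.2 (neg_nonpos.2 ?_))).trans h3
      positivity
    · refine Eventually.of_forall fun x => ?_
      have h2 := ((Real.continuous_exp.tendsto _).comp
        (hs0.div_const (4 * x ^ 2)).neg).const_mul (thetaTail x)
      simpa using h2
  have h2 : Tendsto (fun n : ℕ => ∫ x in Ioi 0,
      thetaTail x * Real.exp (-((((n : ℝ) + 1)⁻¹) ^ 2 / (4 * x ^ 2)))) atTop (𝓝 √Real.pi) := by
    have hN : Tendsto (fun n : ℕ => (n : ℝ) + 1) atTop atTop :=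
      tendsto_atTop_add_const_right _ _ tendsto_natCast_atTop_atTop
    have h3 := (tendsto_mul_one_sub_exp 1).comp hN
    have h4 : Tendsto (fun n : ℕ => Real.exp (-((n : ℝ) + 1)⁻¹)) atTop (𝓝 1) := by
      have := (Real.continuous_exp.tendsto _).comp (tendsto_inv_atTop_zero.comp hN).neg
      rwa [neg_zero, Real.exp_zero] at this
    have h5 := (h4.div h3 one_ne_zero).const_mul √Real.pi
    rw [div_one, mul_one] at h5
    refine h5.congr fun n => ?_
    rw [integral_thetaTail_mul_exp (by positivity), Real.sqrt_sq (by positivity)]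
    simp only [Pi.div_apply, Function.comp, one_div]
    have h6 : Real.exp (-((n : ℝ) + 1)⁻¹) < 1 :=
      Real.exp_lt_one_iff.2 (neg_neg_of_pos (by positivity))
    have h7 : 1 - Real.exp (-((n : ℝ) + 1)⁻¹) ≠ 0 := by linarith
    field_simp
  exact tendsto_nhds_unique h1 h2

end ThetaIntegral

/-! ### The schedule at threshold 2 -/

section Schedule

theorem inTree_nil (bit : Node → Bool) : InTree bit [] := by
  intro u hu hne
  exact absurd (List.prefix_nil.1 hu) hne

theorem inTree_concat {bit : Node → Bool} {p : Node} {b : Bool} :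
    InTree bit (p ++ [b]) ↔ InTree bit p ∧ bit p = true := by
  constructor
  · intro h
    refine ⟨fun u hu _ => h u (hu.trans (List.prefix_append _ _)) fun he => ?_,
      h p (List.prefix_append _ _) fun he => ?_⟩
    · have := hu.length_le
      rw [he, List.length_append, List.length_singleton] at this
      lia
    · have := congrArg List.length he
      simp at this
  · rintro ⟨h1, h2⟩ u hu hne
    rcases List.prefix_concat_iff.1 hu with h3 | h3
    · exact absurd h3 hne
    · by_cases h4 : u = p
      · rw [h4, h2]
      · exact h1 u h3 h4

theorem InTree.of_prefix {bit : Node → Bool} {u v : Node} (hv : InTree bit v) (h : u <+: v) :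
    InTree bit u := by
  intro w hw hne
  refine hv w (hw.trans h) fun he => hne (hw.eq_of_length_le ?_)
  rw [he]
  exact h.length_le

/-- The number of rounds that precede the processing of a node. -/
def procTime (v : Node) : ℕ :=
  if v.getLast? = some false then 2 * v.length - 1 else 2 * v.length

theorem procTime_nil : procTime [] = 0 := rfl

theorem procTime_concat_false (p : Node) : procTime (p ++ [false]) = 2 * p.length + 1 := by
  simp [procTime]; lia

theorem procTime_concat_true (p : Node) : procTime (p ++ [true]) = 2 * p.length + 2 := by
  simp [procTime]; lia

/-- In the rounds of odd number, every thread holds exactly the two children of one node. -/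
theorem mem_threads_odd (bit : Node → Bool) (m : ℕ) :
    (∀ th ∈ threads 2 bit (2 * m + 1), th = ⟨[], []⟩ ∨
      ∃ p : Node, p.length = m ∧ InTree bit p ∧ bit p = true ∧ th = ⟨p.children, []⟩) ∧
    ∀ p : Node, p.length = m → InTree bit p → bit p = true →
      ⟨p.children, []⟩ ∈ threads 2 bit (2 * m + 1) := by
  induction m with
  | zero =>
    constructor
    · intro th hth
      by_cases hb : bit [] = true
      · right
        refine ⟨[], rfl, inTree_nil bit, hb, ?_⟩
        simpa [threads, Thread.step, Thread.pop, hb] using hth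
      · left
        simpa [threads, Thread.step, Thread.pop, hb] using hth
    · intro p hp _ hb
      obtain rfl := List.length_eq_zero_iff.1 hp
      simp [threads, Thread.step, Thread.pop, hb]
  | succ m ih =>
    obtain ⟨ih1, ih2⟩ := ih
    have e : threads 2 bit (2 * (m + 1) + 1) =
      ((threads 2 bit (2 * m + 1)).flatMap (Thread.step 2 bit)).flatMap (Thread.step 2 bit) := rfl
    rw [e]
    constructor
    · intro th hth
      simp only [List.mem_flatMap] at hth
      obtain ⟨th2, ⟨th1, h1, h2⟩, h3⟩ := hth
      rcases ih1 th1 h1 with rfl | ⟨p, hp, hpt, hpb, rfl⟩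
      · simp [Thread.step, Thread.pop] at h2
      · by_cases hb0 : bit (p ++ [false]) = true
        -- After the removal of the first child one node is left in `lds₁`, below the threshold, so
        -- the new children join `lds₁`.
        · have h4 : th2 = ⟨(p ++ [true]) :: Node.children (p ++ [false]), []⟩ := by
            simpa [Thread.step, Thread.pop, Node.children, hb0] using h2
          subst h4
          by_cases hb1 : bit (p ++ [true]) = true
          · have h5 : th = ⟨Node.children (p ++ [false]), []⟩ ∨
                th = ⟨Node.children (p ++ [true]), []⟩ := by
              simpa [Thread.step, Thread.pop, Node.children, hb1] using h3
            rcases h5 with rfl | rfl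
            · exact Or.inr ⟨p ++ [false], by simp [hp], inTree_concat.2 ⟨hpt, hpb⟩, hb0, rfl⟩
            · exact Or.inr ⟨p ++ [true], by simp [hp], inTree_concat.2 ⟨hpt, hpb⟩, hb1, rfl⟩
          · have h5 : th = ⟨Node.children (p ++ [false]), []⟩ := by
              simpa [Thread.step, Thread.pop, Node.children, hb1] using h3
            exact Or.inr ⟨p ++ [false], by simp [hp], inTree_concat.2 ⟨hpt, hpb⟩, hb0, h5⟩
        · have h4 : th2 = ⟨[p ++ [true]], []⟩ := by
            simpa [Thread.step, Thread.pop, Node.children, hb0] using h2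
          subst h4
          by_cases hb1 : bit (p ++ [true]) = true
          · have h5 : th = ⟨Node.children (p ++ [true]), []⟩ := by
              simpa [Thread.step, Thread.pop, Node.children, hb1] using h3
            exact Or.inr ⟨p ++ [true], by simp [hp], inTree_concat.2 ⟨hpt, hpb⟩, hb1, h5⟩
          · left
            simpa [Thread.step, Thread.pop, Node.children, hb1] using h3
    · intro p' hp' hpt' hpb'
      obtain ⟨p, b, rfl⟩ : ∃ p b, p' = p ++ [b] := by
        rcases List.eq_nil_or_concat p' with rfl | h
        · simp at hp'
        · simpa [List.concat_eq_append] using h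
      obtain ⟨hpt, hpb⟩ := inTree_concat.1 hpt'
      have h1 := ih2 p (by simpa using hp') hpt hpb
      simp only [List.mem_flatMap]
      refine ⟨⟨(p ++ [true]) :: (if bit (p ++ [false]) = true then Node.children (p ++ [false])
        else []), []⟩, ⟨_, h1, ?_⟩, ?_⟩
      · by_cases hb0 : bit (p ++ [false]) = true <;>
          simp [Thread.step, Thread.pop, Node.children, hb0]
      · cases b
        · by_cases hb1 : bit (p ++ [true]) = true <;>
            simp [Thread.step, Thread.pop, Node.children, hb1, hpb']
        · by_cases hb0 : bit (p ++ [false]) = true <;>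
            simp [Thread.step, Thread.pop, Node.children, hb0, hpb']

theorem processedAfter_zero_iff {bit : Node → Bool} {v : Node} :
    ProcessedAfter 2 bit 0 v ↔ v = [] := by
  simp [ProcessedAfter, threads, Thread.pop, eq_comm]

theorem processedAfter_odd_iff {bit : Node → Bool} {m : ℕ} {v : Node} :
    ProcessedAfter 2 bit (2 * m + 1) v ↔
      ∃ p : Node, p.length = m ∧ InTree bit p ∧ bit p = true ∧ v = p ++ [false] := by
  obtain ⟨h1, h2⟩ := mem_threads_odd bit m
  constructor
  · rintro ⟨th, hth, th', h3⟩
    rcases h1 th hth with rfl | ⟨p, hp, hpt, hpb, rfl⟩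
    · simp [Thread.pop] at h3
    · refine ⟨p, hp, hpt, hpb, ?_⟩
      simp only [Node.children, Thread.pop, Option.some.injEq, Prod.mk.injEq] at h3
      exact h3.1.symm
  · rintro ⟨p, hp, hpt, hpb, rfl⟩
    exact ⟨_, h2 p hp hpt hpb, ⟨[p ++ [true]], []⟩, rfl⟩

theorem processedAfter_even_iff {bit : Node → Bool} {m : ℕ} {v : Node} :
    ProcessedAfter 2 bit (2 * m + 2) v ↔
      ∃ p : Node, p.length = m ∧ InTree bit p ∧ bit p = true ∧ v = p ++ [true] := by
  obtain ⟨h1, h2⟩ := mem_threads_odd bit m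
  have e : threads 2 bit (2 * m + 2) =
    (threads 2 bit (2 * m + 1)).flatMap (Thread.step 2 bit) := rfl
  have hstep : ∀ p : Node, Thread.step 2 bit ⟨p.children, []⟩ =
      [⟨(p ++ [true]) :: (if bit (p ++ [false]) = true then Node.children (p ++ [false])
        else []), []⟩] := by
    intro p
    by_cases hb0 : bit (p ++ [false]) = true <;>
      simp [Thread.step, Thread.pop, Node.children, hb0]
  constructor
  · rintro ⟨th, hth, th', h3⟩
    rw [e, List.mem_flatMap] at hth
    obtain ⟨th1, h4, h5⟩ := hth
    rcases h1 th1 h4 with rfl | ⟨p, hp, hpt, hpb, rfl⟩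
    · simp [Thread.step, Thread.pop] at h5
    · refine ⟨p, hp, hpt, hpb, ?_⟩
      rw [hstep, List.mem_singleton] at h5
      subst h5
      simp only [Thread.pop, Option.some.injEq, Prod.mk.injEq] at h3
      exact h3.1.symm
  · rintro ⟨p, hp, hpt, hpb, rfl⟩
    refine ⟨⟨(p ++ [true]) :: (if bit (p ++ [false]) = true then Node.children (p ++ [false])
        else []), []⟩, ?_, _, rfl⟩
    rw [e, List.mem_flatMap]
    exact ⟨_, h2 p hp hpt hpb, by rw [hstep, List.mem_singleton]⟩

theorem processedAfter_iff {bit : Node → Bool} {k : ℕ} {v : Node} :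
    ProcessedAfter 2 bit k v ↔ InTree bit v ∧ k = procTime v := by
  rcases List.eq_nil_or_concat v with rfl | ⟨q, b, rfl⟩
  · rw [procTime_nil]
    rcases k with _ | k
    · simp [processedAfter_zero_iff, inTree_nil]
    · rcases Nat.even_or_odd' k with ⟨m, rfl | rfl⟩
      · simp [processedAfter_odd_iff]
      · simp [processedAfter_even_iff]
  · rw [List.concat_eq_append, inTree_concat]
    rcases k with _ | k
    · cases b
      · simp [processedAfter_zero_iff, procTime_concat_false]
      · simp [processedAfter_zero_iff, procTime_concat_true]
    · rcases Nat.even_or_odd' k with ⟨m, rfl | rfl⟩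
      · rw [processedAfter_odd_iff]
        constructor
        · rintro ⟨p, hp, hpt, hpb, he⟩
          obtain ⟨rfl, hb⟩ := List.append_inj' he rfl
          obtain rfl : b = false := by simpa using hb
          exact ⟨⟨hpt, hpb⟩, by rw [procTime_concat_false, hp]⟩
        · rintro ⟨⟨hpt, hpb⟩, hk⟩
          cases b
          · rw [procTime_concat_false] at hk
            exact ⟨q, by lia, hpt, hpb, rfl⟩
          · rw [procTime_concat_true] at hk
            lia
      · rw [processedAfter_even_iff]
        constructor
        · rintro ⟨p, hp, hpt, hpb, he⟩
          obtain ⟨rfl, hb⟩ := List.append_inj' he rfl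
          obtain rfl : b = true := by simpa using hb
          exact ⟨⟨hpt, hpb⟩, by rw [procTime_concat_true, hp]⟩
        · rintro ⟨⟨hpt, hpb⟩, hk⟩
          cases b
          · rw [procTime_concat_false] at hk
            lia
          · rw [procTime_concat_true] at hk
            exact ⟨q, by lia, hpt, hpb, rfl⟩

theorem procTime_add_one_or (v : Node) :
    procTime v + 1 = 2 * v.level ∨ procTime v = 2 * v.level := by
  rcases List.eq_nil_or_concat v with rfl | ⟨q, b, rfl⟩
  · exact Or.inr rfl
  · rw [List.concat_eq_append]
    cases b
    · left; rw [procTime_concat_false]; simp [Node.level]; lia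
    · right; rw [procTime_concat_true]; simp [Node.level]; lia

/-- A thread is live exactly when it pops a node, so the end of the run is the first processing time
that no node of the tree uses. -/
theorem runningTime_eq (bit : Node → Bool) :
    runningTime 2 bit = sInf {k | ∀ v ∈ treeNodes bit, k ≠ procTime v} := by
  rw [runningTime]
  congr 1
  ext k
  have h : (∀ th ∈ threads 2 bit k, th.pop = none) ↔ ∀ v, ¬ ProcessedAfter 2 bit k v := by
    constructor
    · rintro h v ⟨th, hth, th', he⟩
      rw [h th hth] at he
      exact absurd he (by simp)
    · intro h th hth
      rcases he : th.pop with _ | ⟨v, th'⟩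
      · rfl
      · exact absurd ⟨th, hth, th', he⟩ (h v)
  simp only [Set.mem_ofPred_eq, h, processedAfter_iff, not_and]
  rfl

/-- No node is processed later than `2 * H`. Before that no round is idle: the ancestors of a
deepest node are internal, and their two children fill an odd and an even time at every level. -/
theorem runningTime_bounds {bit : Node → Bool} {H : ℕ}
    (hH : IsGreatest (Node.level '' treeNodes bit) H) :
    2 * H ≤ runningTime 2 bit ∧ runningTime 2 bit ≤ 2 * H + 1 := by
  rw [runningTime_eq]
  obtain ⟨⟨w, hw, hwH⟩, hub⟩ := hH
  have hmem : 2 * H + 1 ∈ {k | ∀ v ∈ treeNodes bit, k ≠ procTime v} := by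
    intro v hv he
    have h1 : v.level ≤ H := hub ⟨v, hv, rfl⟩
    rcases procTime_add_one_or v with h2 | h2 <;> lia
  refine ⟨le_csInf ⟨_, hmem⟩ fun k hk => ?_, Nat.sInf_le hmem⟩
  by_contra! hlt
  have hpre : ∀ m < H, InTree bit (w.take m) ∧ bit (w.take m) = true ∧ (w.take m).length = m := by
    intro m hm
    have hl : (w.take m).length = m := by
      rw [List.length_take, min_eq_left]
      exact (hm.trans_eq hwH.symm).le
    refine ⟨InTree.of_prefix hw (List.take_prefix m w), hw _ (List.take_prefix m w) ?_, hl⟩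
    intro he
    rw [he] at hl
    exact absurd (hl.symm.trans hwH) hm.ne
  rcases k with _ | k
  · exact hk [] (inTree_nil bit) rfl
  · rcases Nat.even_or_odd' k with ⟨m, rfl | rfl⟩
    · obtain ⟨h1, h2, h3⟩ := hpre m (by lia)
      exact hk _ (inTree_concat.2 ⟨h1, h2⟩ : InTree bit (w.take m ++ [false]))
        (by rw [procTime_concat_false, h3])
    · obtain ⟨h1, h2, h3⟩ := hpre m (by lia)
      exact hk _ (inTree_concat.2 ⟨h1, h2⟩ : InTree bit (w.take m ++ [true]))
        (by rw [procTime_concat_true, h3])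

end Schedule

/-! ### Bit assignments and binary trees -/

section Shape

open BinaryTree Finset

/-- The set of nodes, internal and external, of a binary tree. -/
def nodeFinset : BinaryTree Unit → Finset Node
  | .nil => {[]}
  | .node _ l r => insert [] ((nodeFinset l).map ⟨List.cons false, List.cons_injective⟩ ∪
      (nodeFinset r).map ⟨List.cons true, List.cons_injective⟩)

/-- The bits drawn at the nodes of a binary tree: `true` exactly at the internal nodes. -/
def treeBit : BinaryTree Unit → Node → Bool
  | .nil, _ => false
  | .node _ _ _, [] => true
  | .node _ l _, false :: u => treeBit l u
  | .node _ _ r, true :: u => treeBit r u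

/-- The tree determined by the bits is the given binary tree. -/
def HasShape (bit : Node → Bool) (t : BinaryTree Unit) : Prop :=
  ∀ u ∈ nodeFinset t, bit u = treeBit t u

theorem card_nodeFinset (t : BinaryTree Unit) : #(nodeFinset t) = 2 * t.numNodes + 1 := by
  induction t with
  | nil => rfl
  | node _ l r ihl ihr =>
    rw [nodeFinset, card_insert_of_notMem (by simp), card_union_of_disjoint, card_map, card_map,
      ihl, ihr, BinaryTree.numNodes]
    · lia
    · rw [disjoint_left]
      intro u h1 h2
      simp only [mem_map, Function.Embedding.coeFn_mk] at h1 h2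
      obtain ⟨a, -, rfl⟩ := h1
      obtain ⟨b, -, h⟩ := h2
      simp at h

theorem cons_mem_nodeFinset {x : Unit} {l r : BinaryTree Unit} {b : Bool} {u : Node} :
    b :: u ∈ nodeFinset (.node x l r) ↔ u ∈ nodeFinset (bif b then r else l) := by
  cases b <;> simp [nodeFinset]

theorem nil_mem_nodeFinset (t : BinaryTree Unit) : [] ∈ nodeFinset t := by
  cases t <;> simp [nodeFinset]

theorem hasShape_nil {bit : Node → Bool} : HasShape bit .nil ↔ bit [] = false := by
  simp [HasShape, nodeFinset, treeBit]

theorem hasShape_node {bit : Node → Bool} {x : Unit} {l r : BinaryTree Unit} :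
    HasShape bit (.node x l r) ↔ bit [] = true ∧ HasShape (fun u => bit (false :: u)) l ∧
      HasShape (fun u => bit (true :: u)) r := by
  constructor
  · intro h
    refine ⟨h [] (nil_mem_nodeFinset _), fun u hu => ?_, fun u hu => ?_⟩
    · exact h (false :: u) (cons_mem_nodeFinset.2 hu)
    · exact h (true :: u) (cons_mem_nodeFinset.2 hu)
  · rintro ⟨h1, h2, h3⟩ u hu
    rcases u with _ | ⟨_ | _, u⟩
    · exact h1
    · exact h2 u (cons_mem_nodeFinset.1 hu)
    · exact h3 u (cons_mem_nodeFinset.1 hu)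

theorem HasShape.unique {bit : Node → Bool} {t t' : BinaryTree Unit} (h : HasShape bit t)
    (h' : HasShape bit t') : t = t' := by
  induction t generalizing bit t' with
  | nil =>
    cases t' with
    | nil => rfl
    | node _ l r => rw [hasShape_nil] at h; rw [hasShape_node, h] at h'; simp at h'
  | node x l r ihl ihr =>
    cases t' with
    | nil => rw [hasShape_nil] at h'; rw [hasShape_node, h'] at h; simp at h
    | node _ l' r' =>
      rw [hasShape_node] at h h'
      rw [ihl h.2.1 h'.2.1, ihr h.2.2 h'.2.2]

theorem inTree_cons {bit : Node → Bool} {b : Bool} {u : Node} :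
    InTree bit (b :: u) ↔ bit [] = true ∧ InTree (fun w => bit (b :: w)) u := by
  constructor
  · intro h
    refine ⟨h [] List.nil_prefix (by simp), fun w hw hne => ?_⟩
    exact h (b :: w) ((List.prefix_cons_inj b).2 hw) (by simpa using hne)
  · rintro ⟨h1, h2⟩ w hw hne
    rcases List.prefix_cons_iff.1 hw with rfl | ⟨w', rfl, hw'⟩
    · exact h1
    · exact h2 w' hw' (by simpa using hne)

theorem HasShape.treeNodes_eq {bit : Node → Bool} {t : BinaryTree Unit} (h : HasShape bit t) :
    treeNodes bit = nodeFinset t := by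
  ext v
  change InTree bit v ↔ v ∈ nodeFinset t
  induction t generalizing bit v with
  | nil =>
    rw [hasShape_nil] at h
    rcases v with _ | ⟨b, u⟩
    · simp [inTree_nil, nodeFinset]
    · simp [inTree_cons, h, nodeFinset]
  | node x l r ihl ihr =>
    rw [hasShape_node] at h
    rcases v with _ | ⟨_ | _, u⟩
    · simp [inTree_nil, nodeFinset]
    · rw [inTree_cons, cons_mem_nodeFinset, ihl h.2.1]; simp [h.1]
    · rw [inTree_cons, cons_mem_nodeFinset, ihr h.2.2]; simp [h.1]

/-- Induction on a strict bound for the levels: passing to the subtree of a child lowers it by one.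
-/
theorem exists_hasShape_of_level_lt (N : ℕ) (bit : Node → Bool)
    (h : ∀ v, InTree bit v → v.length < N) : ∃ t, HasShape bit t := by
  induction N generalizing bit with
  | zero => exact absurd (h [] (inTree_nil bit)) (by simp)
  | succ N ih =>
    by_cases hb : bit [] = true
    · have hsub : ∀ b, ∃ t, HasShape (fun u => bit (b :: u)) t := fun b =>
        ih _ fun v hv => by simpa using h (b :: v) (inTree_cons.2 ⟨hb, hv⟩)
      obtain ⟨l, hl⟩ := hsub false
      obtain ⟨r, hr⟩ := hsub true
      exact ⟨.node () l r, hasShape_node.2 ⟨hb, hl, hr⟩⟩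
    · exact ⟨.nil, hasShape_nil.2 (by simpa using hb)⟩

theorem exists_hasShape {bit : Node → Bool} (h : (treeNodes bit).Finite) :
    ∃ t, HasShape bit t := by
  refine exists_hasShape_of_level_lt (h.toFinset.sup List.length + 1) bit fun v hv => ?_
  exact Nat.lt_succ_of_le (Finset.le_sup (f := List.length) (h.mem_toFinset.2 hv))

theorem encard_treeNodes_eq_iff {bit : Node → Bool} {n : ℕ} :
    (treeNodes bit).encard = 2 * (n : ℕ∞) + 1 ↔ ∃ t ∈ treesOfNumNodesEq n, HasShape bit t := by
  constructor
  · intro h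
    have hfin : (treeNodes bit).Finite := by
      rw [← Set.encard_ne_top_iff, h]
      exact_mod_cast ENat.natCast_ne_top (2 * n + 1)
    obtain ⟨t, ht⟩ := exists_hasShape hfin
    refine ⟨t, ?_, ht⟩
    rw [ht.treeNodes_eq, Set.encard_coe_eq_coe_finsetCard, card_nodeFinset] at h
    have : 2 * t.numNodes + 1 = 2 * n + 1 := by exact_mod_cast h
    rw [mem_treesOfNumNodesEq]
    lia
  · rintro ⟨t, ht, hs⟩
    rw [mem_treesOfNumNodesEq] at ht
    rw [hs.treeNodes_eq, Set.encard_coe_eq_coe_finsetCard, card_nodeFinset, ht]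
    norm_cast

theorem isGreatest_level_nodeFinset (t : BinaryTree Unit) :
    IsGreatest (Node.level '' (nodeFinset t : Set Node)) t.height := by
  induction t with
  | nil =>
    simp only [nodeFinset, coe_singleton, Set.image_singleton, BinaryTree.height]
    exact isGreatest_singleton
  | node x l r ihl ihr =>
    obtain ⟨⟨vl, hvl, hl⟩, hubl⟩ := ihl
    obtain ⟨⟨vr, hvr, hr⟩, hubr⟩ := ihr
    rw [BinaryTree.height]
    constructor
    · rcases le_total l.height r.height with hle | hle
      · refine ⟨true :: vr, mem_coe.2 (cons_mem_nodeFinset.2 hvr), ?_⟩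
        rw [max_eq_right hle, ← hr]; rfl
      · refine ⟨false :: vl, mem_coe.2 (cons_mem_nodeFinset.2 hvl), ?_⟩
        rw [max_eq_left hle, ← hl]; rfl
    · rintro _ ⟨v, hv, rfl⟩
      rw [mem_coe] at hv
      rcases v with _ | ⟨_ | _, u⟩
      · exact Nat.zero_le _
      · have : u.length ≤ l.height := hubl ⟨u, cons_mem_nodeFinset.1 hv, rfl⟩
        simp only [Node.level, List.length_cons]; lia
      · have : u.length ≤ r.height := hubr ⟨u, cons_mem_nodeFinset.1 hv, rfl⟩
        simp only [Node.level, List.length_cons]; lia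

theorem HasShape.isGreatest {bit : Node → Bool} {t : BinaryTree Unit} (h : HasShape bit t) :
    IsGreatest (Node.level '' treeNodes bit) t.height := by
  rw [h.treeNodes_eq]
  exact isGreatest_level_nodeFinset t

theorem HasShape.height_eq {bit : Node → Bool} {t : BinaryTree Unit} (h : HasShape bit t) :
    height bit = t.height := h.isGreatest.csSup_eq

theorem HasShape.runningTime_bounds {bit : Node → Bool} {t : BinaryTree Unit}
    (h : HasShape bit t) :
    2 * t.height ≤ runningTime 2 bit ∧ runningTime 2 bit ≤ 2 * t.height + 1 :=
  ParallelGW.runningTime_bounds h.isGreatest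

/-- Bits outside the tree are never drawn, so the running time is a function of the shape. This
makes it a statistic of uniform trees. -/
theorem HasShape.runningTime_eq_treeBit {bit : Node → Bool} {t : BinaryTree Unit}
    (h : HasShape bit t) : runningTime 2 bit = runningTime 2 (treeBit t) := by
  have ht : HasShape (treeBit t) t := fun _ _ => rfl
  rw [runningTime_eq, runningTime_eq, h.treeNodes_eq, ht.treeNodes_eq]

end Shape

/-! ### Limit law and mean for statistics within one of twice the height -/

section UniformTrees

open BinaryTree Finset Filter Topology MeasureTheory

/-- The proportion of the binary trees with `n` internal nodes which have a given property. -/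
noncomputable def treeRatio (n : ℕ) (S : BinaryTree Unit → Prop) [DecidablePred S] : ℝ :=
  (#{t ∈ treesOfNumNodesEq n | S t} : ℝ) / catalan n

theorem treeRatio_mono {n : ℕ} {S S' : BinaryTree Unit → Prop} [DecidablePred S]
    [DecidablePred S'] (h : ∀ t, S t → S' t) : treeRatio n S ≤ treeRatio n S' := by
  unfold treeRatio
  gcongr with t _
  exact h t

theorem treeRatio_nonneg (n : ℕ) (S : BinaryTree Unit → Prop) [DecidablePred S] :
    0 ≤ treeRatio n S := by unfold treeRatio; positivity

theorem treeRatio_height_le (n h : ℕ) : treeRatio n (fun t => t.height ≤ h) = heightRatio h n := by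
  rw [treeRatio, card_filter_height_le, heightRatio]

theorem treeRatio_not (n : ℕ) (S : BinaryTree Unit → Prop) [DecidablePred S] :
    treeRatio n (fun t => ¬ S t) = 1 - treeRatio n S := by
  have h1 := card_filter_add_card_filter_not (s := treesOfNumNodesEq n) S
  rw [treesOfNumNodesEq_card_eq_catalan] at h1
  have h2 := catalan_pos n
  rw [treeRatio, treeRatio, eq_sub_iff_add_eq, ← add_div, div_eq_one_iff_eq (by positivity),
    add_comm]
  exact_mod_cast h1

theorem treeRatio_lt (n : ℕ) (f : BinaryTree Unit → ℝ) (x : ℝ) :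
    treeRatio n (fun t => x < f t) = 1 - treeRatio n (fun t => f t ≤ x) := by
  simp only [← treeRatio_not, not_le]

variable {F : BinaryTree Unit → ℕ}

/-- An additive error of `1` is negligible against `√n`: the distribution function is squeezed
between height ratios at the floor `k` of `2 √π x √n` and at `k - 1`. For `x ≤ 0` the event forces
height `0`, impossible when `n > 0`. -/
theorem tendsto_treeRatio_le (hF : ∀ t, 2 * t.height ≤ F t ∧ F t ≤ 2 * t.height + 1) (x : ℝ) :
    Tendsto (fun n : ℕ => treeRatio n (fun t => (F t : ℝ) / (4 * √(Real.pi * n)) ≤ x)) atTop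
      (𝓝 (thetaCDF (√Real.pi * x))) := by
  have hpi := Real.sqrt_pos.2 Real.pi_pos
  have hpos : ∀ n : ℕ, 0 < n → 0 < 4 * √(Real.pi * n) := fun n hn => by
    have := Real.pi_pos
    positivity
  rcases le_or_gt x 0 with hx | hx
  · rw [thetaCDF, if_pos (mul_nonpos_of_nonneg_of_nonpos hpi.le hx)]
    refine tendsto_const_nhds.congr' ?_
    filter_upwards [eventually_gt_atTop 0] with n hn
    refine le_antisymm (treeRatio_nonneg _ _) ?_
    obtain ⟨m, rfl⟩ := Nat.exists_eq_succ_of_ne_zero hn.ne'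
    rw [← heightRatio_zero_succ m, ← treeRatio_height_le]
    refine treeRatio_mono fun t ht => ?_
    rw [div_le_iff₀ (hpos _ hn)] at ht
    have h1 : (F t : ℝ) ≤ 0 :=
      ht.trans (mul_nonpos_of_nonpos_of_nonneg hx (hpos _ hn).le)
    have h2 : F t = 0 := by
      rw [← Nat.le_zero]
      exact_mod_cast h1
    have := (hF t).1
    lia
  · have hy : 0 < √Real.pi * x := by positivity
    rw [thetaCDF_of_pos hy]
    have hfl := tendsto_floor_mul_sqrt_div (c := 2 * (√Real.pi * x)) (by positivity)
    have hinv : Tendsto (fun n : ℕ => 1 / √(n : ℝ)) atTop (𝓝 0) :=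
      tendsto_const_nhds.div_atTop (Real.tendsto_sqrt_atTop.comp tendsto_natCast_atTop_atTop)
    have htop := (tendsto_natCast_div_sq hy hfl).1
    -- Height at most `k - 1` gives a statistic of at most `2 * (k - 1) + 1 ≤ 2 * k`, for `k ≥ 1`.
    have hfl' : Tendsto (fun n : ℕ => ((⌊2 * (√Real.pi * x) * √(n : ℝ)⌋₊ - 1 : ℕ) : ℝ) / √(n : ℝ))
        atTop (𝓝 (2 * (√Real.pi * x))) := by
      have h1 := hfl.sub hinv
      rw [sub_zero] at h1
      refine h1.congr' ?_
      filter_upwards [htop.eventually_ge_atTop 1] with n hn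
      rw [Nat.cast_sub hn, sub_div, Nat.cast_one]
    have hup := (tendsto_tail_of_div_sqrt hy hfl).const_sub 1
    have hlo := (tendsto_tail_of_div_sqrt hy hfl').const_sub 1
    simp only [sub_sub_cancel] at hup hlo
    have hscale : ∀ n : ℕ, x * (4 * √(Real.pi * n)) = 2 * (2 * (√Real.pi * x) * √(n : ℝ)) := by
      intro n
      rw [Real.sqrt_mul Real.pi_pos.le]
      ring
    refine tendsto_of_tendsto_of_tendsto_of_le_of_le' hlo hup ?_ ?_
    · filter_upwards [eventually_gt_atTop 0, htop.eventually_ge_atTop 1] with n hn h1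
      rw [← treeRatio_height_le]
      refine treeRatio_mono fun t ht => ?_
      rw [div_le_iff₀ (hpos n hn), hscale]
      have h2 := Nat.floor_le (a := 2 * (√Real.pi * x) * √(n : ℝ)) (by positivity)
      have h3 : F t ≤ 2 * ⌊2 * (√Real.pi * x) * √(n : ℝ)⌋₊ := by
        have := (hF t).2
        lia
      have h4 : (F t : ℝ) ≤ 2 * (⌊2 * (√Real.pi * x) * √(n : ℝ)⌋₊ : ℝ) := by exact_mod_cast h3
      linarith
    · filter_upwards [eventually_gt_atTop 0] with n hn
      rw [← treeRatio_height_le]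
      refine treeRatio_mono fun t ht => ?_
      rw [div_le_iff₀ (hpos n hn), hscale] at ht
      refine Nat.le_floor ?_
      have h4 : ((2 * t.height : ℕ) : ℝ) ≤ F t := by exact_mod_cast (hF t).1
      push_cast at h4
      linarith

/-- Integrable domination, uniform in large `n`, for the layer-cake integral of the mean. -/
theorem exists_treeRatio_lt_bound (hF : ∀ t, 2 * t.height ≤ F t ∧ F t ≤ 2 * t.height + 1) :
    ∃ C : ℝ, ∀ᶠ n : ℕ in atTop, ∀ x : ℝ, 0 < x →
      treeRatio n (fun t => x < (F t : ℝ) / (4 * √(Real.pi * n))) ≤ C * (1 + x ^ 2)⁻¹ := by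
  obtain ⟨C, hC0, hC⟩ := exists_tail_bound
  refine ⟨2 + 4 * C, ?_⟩
  filter_upwards [hC, eventually_gt_atTop 0] with n hn hn0 x hx
  have hn1 : (1 : ℝ) ≤ n := by exact_mod_cast hn0
  have hpi3 := Real.pi_gt_three
  have hpos : 0 < 4 * √(Real.pi * n) := by positivity
  rw [← div_eq_mul_inv, le_div_iff₀ (by positivity)]
  have hr0 := treeRatio_nonneg n (fun t => x < (F t : ℝ) / (4 * √(Real.pi * n)))
  have hr1 : treeRatio n (fun t => x < (F t : ℝ) / (4 * √(Real.pi * n))) ≤ 1 := by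
    rw [treeRatio_lt]
    linarith [treeRatio_nonneg n (fun t => (F t : ℝ) / (4 * √(Real.pi * n)) ≤ x)]
  have hy2 : (x * (4 * √(Real.pi * n))) ^ 2 = 16 * Real.pi * n * x ^ 2 := by
    rw [mul_pow, mul_pow, Real.sq_sqrt (by positivity)]
    ring
  set y := x * (4 * √(Real.pi * n)) with hy
  have hy0 : 0 < y := by positivity
  suffices h : treeRatio n (fun t => x < (F t : ℝ) / (4 * √(Real.pi * n))) * x ^ 2 ≤ 1 + 4 * C by
    linarith
  rcases lt_or_ge y 4 with hlt | hge
  -- For a threshold `y < 4` the point `x` is at most `1`, and the trivial bound of a probability by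
  -- `1` suffices.
  · have h1 : x ^ 2 ≤ 1 := by
      have h2 : y ^ 2 < 4 ^ 2 := by gcongr
      rw [hy2] at h2
      have h3 : 3 * x ^ 2 ≤ Real.pi * n * x ^ 2 := by
        gcongr
        nlinarith
      nlinarith [sq_nonneg x]
    nlinarith [sq_nonneg x]
  -- A height of at most `⌊y / 4⌋₊` gives a statistic of at most `y / 2 + 1 ≤ y`; and the floor is
  -- at least `y / 8`.
  · have hfl1 : 1 ≤ ⌊y / 4⌋₊ := Nat.one_le_floor_iff _ |>.2 (by linarith)
    have hfl2 := Nat.floor_le (a := y / 4) (by positivity)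
    have hfl3 := Nat.lt_floor_add_one (y / 4)
    have hfl1' : (1 : ℝ) ≤ (⌊y / 4⌋₊ : ℝ) := by exact_mod_cast hfl1
    have h1 : treeRatio n (fun t => x < (F t : ℝ) / (4 * √(Real.pi * n))) ≤
        1 - heightRatio ⌊y / 4⌋₊ n := by
      rw [← treeRatio_height_le, ← treeRatio_not]
      refine treeRatio_mono fun t ht hle => ?_
      rw [lt_div_iff₀ hpos, ← hy] at ht
      have h2 : (F t : ℝ) ≤ 2 * (⌊y / 4⌋₊ : ℝ) + 1 := by
        have h3 : F t ≤ 2 * ⌊y / 4⌋₊ + 1 := by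
          have := (hF t).2
          lia
        exact_mod_cast h3
      linarith
    have h2 := h1.trans (hn _ hfl1)
    have h3 : y / 8 ≤ (⌊y / 4⌋₊ : ℝ) := by linarith
    have h4 : C * n / (⌊y / 4⌋₊ : ℝ) ^ 2 ≤ C * n / (y / 8) ^ 2 := by gcongr
    have h5 : C * n / (y / 8) ^ 2 = 4 * C / (Real.pi * x ^ 2) := by
      rw [div_pow, hy2]
      field_simp
      norm_num
    rw [h5] at h4
    have h6 := h2.trans h4
    calc _ ≤ 4 * C / (Real.pi * x ^ 2) * x ^ 2 := by gcongr
      _ = 4 * C / Real.pi := by field_simp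
      _ ≤ 4 * C / 1 := by gcongr; linarith
      _ ≤ 1 + 4 * C := by linarith

theorem tendsto_integral_treeRatio_lt (hF : ∀ t, 2 * t.height ≤ F t ∧ F t ≤ 2 * t.height + 1) :
    Tendsto (fun n : ℕ => ∫ x in Set.Ioi (0 : ℝ),
      treeRatio n (fun t => x < (F t : ℝ) / (4 * √(Real.pi * n)))) atTop (𝓝 1) := by
  have hpi := Real.sqrt_pos.2 Real.pi_pos
  have hone : ∫ x in Set.Ioi (0 : ℝ), thetaTail (√Real.pi * x) = 1 := by
    rw [integral_comp_mul_left_Ioi (fun x => thetaTail x) 0 hpi, mul_zero, integral_thetaTail,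
      smul_eq_mul, inv_mul_cancel₀ hpi.ne']
  rw [← hone]
  obtain ⟨C, hC⟩ := exists_treeRatio_lt_bound hF
  refine tendsto_integral_filter_of_dominated_convergence (fun x : ℝ => C * (1 + x ^ 2)⁻¹)
    (Eventually.of_forall fun n => ?_) ?_
    (integrable_inv_one_add_sq.const_mul C).integrableOn ?_
  · refine Measurable.aestronglyMeasurable (Antitone.measurable fun x y hxy => ?_)
    exact treeRatio_mono fun t ht => hxy.trans_lt ht
  · filter_upwards [hC] with n hn
    filter_upwards [ae_restrict_mem measurableSet_Ioi] with x hx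
    rw [Real.norm_of_nonneg (treeRatio_nonneg _ _)]
    exact hn x hx
  · filter_upwards [ae_restrict_mem measurableSet_Ioi] with x hx
    have h1 := (tendsto_treeRatio_le hF x).const_sub 1
    rw [thetaCDF_of_pos (mul_pos hpi hx), sub_sub_cancel] at h1
    exact h1.congr fun n => (treeRatio_lt n _ x).symm

end UniformTrees

/-! ### The law of the conditioned Galton-Watson tree -/

section Probability

open BinaryTree Finset MeasureTheory ProbabilityTheory
open scoped ENNReal

theorem setOf_hasShape {Ω : Type*} {bit : Node → Ω → Bool} (t : BinaryTree Unit) :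
    {ω | HasShape (fun v => bit v ω) t} = ⋂ u ∈ nodeFinset t, bit u ⁻¹' {treeBit t u} := by
  ext ω
  simp [HasShape]

theorem measurableSet_hasShape {Ω : Type*} [MeasurableSpace Ω]
    {bit : Node → Ω → Bool} (hm : ∀ v, Measurable (bit v)) (t : BinaryTree Unit) :
    MeasurableSet {ω | HasShape (fun v => bit v ω) t} := by
  rw [setOf_hasShape]
  exact (nodeFinset t).measurableSet_biInter fun u _ => hm u (measurableSet_singleton _)

/-- The event prescribes one fair bit at each of the `2 n + 1` nodes. The probability depends on the
size only, which is the source of uniformity. -/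
theorem measure_hasShape {Ω : Type*} [MeasurableSpace Ω] {P : Measure Ω}
    [IsProbabilityMeasure P] {bit : Node → Ω → Bool} (hm : ∀ v, Measurable (bit v))
    (hi : iIndepFun bit P) (hp : ∀ v, P {ω | bit v ω = true} = 1 / 2) (t : BinaryTree Unit) :
    P {ω | HasShape (fun v => bit v ω) t} = (1 / 2) ^ (2 * t.numNodes + 1) := by
  have hb : ∀ (v : Node) (b : Bool), P (bit v ⁻¹' {b}) = 1 / 2 := by
    intro v b
    cases b
    · have h1 : bit v ⁻¹' {false} = (bit v ⁻¹' {true})ᶜ := by ext; simp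
      have h2 : P (bit v ⁻¹' {true}) = 1 / 2 := hp v
      rw [h1, prob_compl_eq_one_sub (hm v (measurableSet_singleton _)), h2, one_div,
        ENNReal.one_sub_inv_two]
    · exact hp v
  rw [setOf_hasShape, hi.measure_inter_preimage_eq_mul _ (fun u _ => measurableSet_singleton _),
    prod_congr rfl fun u _ => hb u _, prod_const, card_nodeFinset]

theorem measure_iUnion_hasShape {Ω : Type*} [MeasurableSpace Ω] {P : Measure Ω}
    [IsProbabilityMeasure P] {bit : Node → Ω → Bool} (hm : ∀ v, Measurable (bit v))
    (hi : iIndepFun bit P) (hp : ∀ v, P {ω | bit v ω = true} = 1 / 2) {n : ℕ}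
    {s : Finset (BinaryTree Unit)}
    (hs : s ⊆ treesOfNumNodesEq n) :
    P (⋃ t ∈ s, {ω | HasShape (fun v => bit v ω) t}) = #s * (1 / 2) ^ (2 * n + 1) := by
  rw [measure_biUnion_finset _ fun t _ => measurableSet_hasShape hm t]
  · rw [sum_congr rfl fun t ht => (measure_hasShape hm hi hp t).trans
      (by rw [mem_treesOfNumNodesEq.1 (hs ht)]), sum_const, nsmul_eq_mul]
  · intro t _ t' _ hne
    exact Set.disjoint_left.2 fun ω h h' => hne (HasShape.unique h h')

theorem setOf_encard_eq {Ω : Type*} {bit : Node → Ω → Bool} (n : ℕ) :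
    {ω | (treeNodes (fun v => bit v ω)).encard = 2 * (n : ℕ∞) + 1} =
      ⋃ t ∈ treesOfNumNodesEq n, {ω | HasShape (fun v => bit v ω) t} := by
  ext ω
  simp only [Set.mem_iUnion, exists_prop]
  exact encard_treeNodes_eq_iff

theorem measurableSet_encard_eq {Ω : Type*} [MeasurableSpace Ω]
    {bit : Node → Ω → Bool} (hm : ∀ v, Measurable (bit v)) (n : ℕ) :
    MeasurableSet {ω | (treeNodes (fun v => bit v ω)).encard = 2 * (n : ℕ∞) + 1} := by
  rw [setOf_encard_eq]
  exact (treesOfNumNodesEq n).measurableSet_biUnion fun t _ => measurableSet_hasShape hm t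

theorem measure_encard_eq {Ω : Type*} [MeasurableSpace Ω] {P : Measure Ω}
    [IsProbabilityMeasure P] {bit : Node → Ω → Bool} (hm : ∀ v, Measurable (bit v))
    (hi : iIndepFun bit P) (hp : ∀ v, P {ω | bit v ω = true} = 1 / 2) (n : ℕ) :
    P {ω | (treeNodes (fun v => bit v ω)).encard = 2 * (n : ℕ∞) + 1} =
      catalan n * (1 / 2) ^ (2 * n + 1) := by
  rw [setOf_encard_eq, measure_iUnion_hasShape hm hi hp subset_rfl,
    treesOfNumNodesEq_card_eq_catalan]

/-- Conditioned on its number of nodes, the Galton-Watson tree is uniformly distributed. -/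
theorem cond_real_eq_treeRatio {Ω : Type*} [MeasurableSpace Ω] {P : Measure Ω}
    [IsProbabilityMeasure P] {bit : Node → Ω → Bool} (hm : ∀ v, Measurable (bit v))
    (hi : iIndepFun bit P) (hp : ∀ v, P {ω | bit v ω = true} = 1 / 2) (n : ℕ) {B : Set Ω}
    {S : BinaryTree Unit → Prop} [DecidablePred S]
    (hB : ∀ ω t, HasShape (fun v => bit v ω) t → (ω ∈ B ↔ S t)) :
    (cond P {ω | (treeNodes (fun v => bit v ω)).encard = 2 * (n : ℕ∞) + 1}).real B =
      treeRatio n S := by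
  have h1 : {ω | (treeNodes (fun v => bit v ω)).encard = 2 * (n : ℕ∞) + 1} ∩ B =
      ⋃ t ∈ (treesOfNumNodesEq n).filter S, {ω | HasShape (fun v => bit v ω) t} := by
    rw [setOf_encard_eq]
    ext ω
    simp only [Set.mem_inter_iff, Set.mem_iUnion, exists_prop, mem_filter]
    constructor
    · rintro ⟨⟨t, ht, hs⟩, hb⟩
      exact ⟨t, ⟨ht, (hB ω t hs).1 hb⟩, hs⟩
    · rintro ⟨t, ⟨ht, hst⟩, hs⟩
      exact ⟨⟨t, ht, hs⟩, (hB ω t hs).2 hst⟩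
  have h2 := catalan_pos n
  rw [measureReal_def, cond_apply (measurableSet_encard_eq hm n), h1,
    measure_iUnion_hasShape hm hi hp (filter_subset _ _), measure_encard_eq hm hi hp, treeRatio]
  rw [ENNReal.toReal_mul, ENNReal.toReal_inv, ENNReal.toReal_mul, ENNReal.toReal_mul,
    ENNReal.toReal_natCast, ENNReal.toReal_natCast, ENNReal.toReal_pow]
  have h3 : (0 : ℝ) < ((1 / 2 : ℝ≥0∞).toReal) := by simp
  field_simp

theorem ae_cond_exists_hasShape {Ω : Type*} [MeasurableSpace Ω] {P : Measure Ω}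
    {bit : Node → Ω → Bool} (hm : ∀ v, Measurable (bit v)) (n : ℕ) :
    ∀ᵐ ω ∂(cond P {ω | (treeNodes (fun v => bit v ω)).encard = 2 * (n : ℕ∞) + 1}),
      ∃ t ∈ treesOfNumNodesEq n, HasShape (fun v => bit v ω) t := by
  filter_upwards [ae_cond_mem (measurableSet_encard_eq hm n)] with ω hω
  exact encard_treeNodes_eq_iff.1 hω

/-- Layer cake formula for a functional of the conditioned Galton-Watson tree. -/
theorem integral_cond_eq {Ω : Type*} [MeasurableSpace Ω] {P : Measure Ω}
    [IsProbabilityMeasure P] {bit : Node → Ω → Bool} (hm : ∀ v, Measurable (bit v))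
    (hi : iIndepFun bit P) (hp : ∀ v, P {ω | bit v ω = true} = 1 / 2) (n : ℕ)
    {g : Ω → ℝ} {f : BinaryTree Unit → ℝ}
    (hf : ∀ t, 0 ≤ f t) (hg : ∀ ω t, HasShape (fun v => bit v ω) t → g ω = f t) :
    ∫ ω, g ω ∂(cond P {ω | (treeNodes (fun v => bit v ω)).encard = 2 * (n : ℕ∞) + 1}) =
      ∫ x in Set.Ioi (0 : ℝ), treeRatio n (fun t => x < f t) := by
  set A := {ω | (treeNodes (fun v => bit v ω)).encard = 2 * (n : ℕ∞) + 1} with hA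
  have hae := ae_cond_exists_hasShape (P := P) hm n
  -- Writing `g` almost surely as a finite sum of indicators of shapes gives its integrability,
  -- although `g` is not assumed measurable.
  have hgsum : g =ᵐ[cond P A] fun ω => ∑ t ∈ treesOfNumNodesEq n,
      {ω | HasShape (fun v => bit v ω) t}.indicator (fun _ => f t) ω := by
    filter_upwards [hae] with ω ⟨t, ht, hs⟩
    rw [sum_eq_single t]
    · rw [Set.indicator_of_mem hs, hg ω t hs]
    · intro t' _ hne
      exact Set.indicator_of_notMem (fun hs' => hne (HasShape.unique hs' hs)) _
    · exact fun h => absurd ht h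
  have hint : Integrable g (cond P A) := by
    refine Integrable.congr ?_ hgsum.symm
    exact integrable_finsetSum _ fun t _ =>
      (integrable_const (f t)).indicator (measurableSet_hasShape hm t)
  rw [hint.integral_eq_integral_meas_lt]
  · refine setIntegral_congr_fun measurableSet_Ioi fun x _ => ?_
    refine cond_real_eq_treeRatio hm hi hp n fun ω t hs => ?_
    rw [Set.mem_ofPred_eq, hg ω t hs]
  · filter_upwards [hae] with ω ⟨t, _, hs⟩
    rw [hg ω t hs]
    exact hf t

end Probability

end ParallelGW

/-! ### The theorem -/

theorem mainTheorem5 :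
    -- every node at level `h` is processed in exactly one round, after `2 h - 1` or `2 h` operations
    (∀ (bit : ParallelGW.Node → Bool) (v : ParallelGW.Node), ParallelGW.InTree bit v →
      ∃ k : ℕ, (∀ k' : ℕ, ParallelGW.ProcessedAfter 2 bit k' v ↔ k' = k) ∧
        (k + 1 = 2 * v.level ∨ k = 2 * v.level)) ∧
    -- independent fair bits at the nodes, conditioned on a tree with `2 n + 1` nodes
    (∀ {Ω : Type*} [MeasurableSpace Ω] (P : MeasureTheory.Measure Ω)
      [MeasureTheory.IsProbabilityMeasure P] (bit : ParallelGW.Node → Ω → Bool),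
      (∀ v, Measurable (bit v)) → ProbabilityTheory.iIndepFun bit P →
      (∀ v, P {ω | bit v ω = true} = 1 / 2) →
      ∀ Q : ℕ → MeasureTheory.Measure Ω,
      (∀ n : ℕ, Q n = ProbabilityTheory.cond P
        {ω | (ParallelGW.treeNodes (fun v => bit v ω)).encard = 2 * (n : ℕ∞) + 1}) →
      -- the normalized running time converges in distribution to the (scaled) Theta law
      (∀ x : ℝ, Filter.Tendsto
        (fun n : ℕ => (Q n).real {ω |
          (ParallelGW.runningTime 2 (fun v => bit v ω) : ℝ) / (4 * Real.sqrt (Real.pi * n)) ≤ x})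
        Filter.atTop (nhds (ParallelGW.thetaCDF (Real.sqrt Real.pi * x)))) ∧
      -- with the corresponding asymptotic expectation
      Filter.Tendsto
        (fun n : ℕ => (∫ ω, (ParallelGW.runningTime 2 (fun v => bit v ω) : ℝ) ∂(Q n)) /
          (4 * Real.sqrt (Real.pi * n)))
        Filter.atTop (nhds 1) ∧
      -- the height of the tree has the same limit law with half the normalization
      (∀ x : ℝ, Filter.Tendsto
        (fun n : ℕ => (Q n).real {ω |
          (ParallelGW.height (fun v => bit v ω) : ℝ) / (2 * Real.sqrt (Real.pi * n)) ≤ x})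
        Filter.atTop (nhds (ParallelGW.thetaCDF (Real.sqrt Real.pi * x))))) := by

  refine ⟨fun bit v hv => ⟨ParallelGW.procTime v, fun k' => ?_,
    ParallelGW.procTime_add_one_or v⟩, ?_⟩
  · rw [ParallelGW.processedAfter_iff, and_iff_right hv]
  · intro Ω _ P _ bit hm hi hp Q hQ
    have hT : ∀ t : BinaryTree Unit,
        2 * t.height ≤ ParallelGW.runningTime 2 (ParallelGW.treeBit t) ∧
        ParallelGW.runningTime 2 (ParallelGW.treeBit t) ≤ 2 * t.height + 1 := fun t =>
      ParallelGW.HasShape.runningTime_bounds (fun _ _ => rfl)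
    refine ⟨fun x => ?_, ?_, fun x => ?_⟩
    · refine (ParallelGW.tendsto_treeRatio_le hT x).congr fun n => ?_
      rw [hQ n]
      refine (ParallelGW.cond_real_eq_treeRatio hm hi hp n fun ω t hs => ?_).symm
      rw [Set.mem_ofPred_eq, hs.runningTime_eq_treeBit]
    · refine (ParallelGW.tendsto_integral_treeRatio_lt hT).congr fun n => ?_
      rw [hQ n, ← MeasureTheory.integral_div]
      refine (ParallelGW.integral_cond_eq hm hi hp n (fun t => by positivity)
        fun ω t hs => ?_).symm
      rw [hs.runningTime_eq_treeBit]
    -- The height law is the case of the statistic exactly twice the height, which accounts for the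
    -- halved normalization.
    · refine (ParallelGW.tendsto_treeRatio_le (F := fun t => 2 * t.height)
        (fun t => ⟨le_rfl, Nat.le_succ _⟩) x).congr fun n => ?_
      rw [hQ n]
      refine (ParallelGW.cond_real_eq_treeRatio hm hi hp n fun ω t hs => ?_).symm
      rw [Set.mem_ofPred_eq, hs.height_eq]
      have : ((2 * t.height : ℕ) : ℝ) / (4 * Real.sqrt (Real.pi * n)) =
          (t.height : ℝ) / (2 * Real.sqrt (Real.pi * n)) := by
        push_cast
        rw [show (4 : ℝ) * Real.sqrt (Real.pi * n) = 2 * (2 * Real.sqrt (Real.pi * n)) by ring,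
          mul_div_mul_left _ _ two_ne_zero]
      rw [this]
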